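/- Let $n\ge 3$, $\kappa>0$, $\gamma\in(1,5/3]$, $b>0$, $\nu>0$, and set $\delta=b\nu+(\gamma-1)\kappa$. Consider the Cauchy problem for the linear Blackstock model $$(\partial_t-\kappa\Delta)(\psi_{tt}-\Delta\psi-\delta\Delta\psi_t)+\kappa(\gamma-1)(b\nu-\kappa)\Delta^2\psi_t=0,\qquad \psi(0)=\psi_0,\ \psi_t(0)=\psi_1,\ \psi_{tt}(0)=\psi_2,$$ for $x\in\mathbb{R}^n$, $t>0$. A solution is a (real- or complex-valued) function $\psi\in\mathcal C([0,\infty),L^2(\mathbb R^n))$ which, as a function of $t\in[0,\infty)$ with values in the tempered distributions on $\mathbb{R}^n$, is three times continuously differentiable and satisfies the equation and the initial conditions. Let $L^{1,1}$ be the space of all $f\in L^1(\mathbb R^n)$ with $\|f\|_{L^{1,1}}=\int_{\mathbb{R}^n}(1+|x|)|f(x)|\,dx<\infty$, put $\|f\|_{L^2\cap L^{1,1}}=\|f\|_{L^2}+\|f\|_{L^{1,1}}$ and $P_f=\int_{\mathbb{R}^n}f(x)\,dx$, and let $$\widetilde{\mathcal D}_n(t)=\begin{cases}t^{1/2}&\text{if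 } n=3,\\(\ln t)^{1/2}&\text{if } n=4,\\ t^{1-n/4}&\text{if } n\ge5.\end{cases}$$ Then there are constants $c,C,T_0>0$, depending only on $n,\kappa,\gamma,b,\nu$, such that for all $\psi_0,\psi_1,\psi_2\in L^2\cap L^{1,1}$ with $P_{\psi_2}\neq0$ and every solution $\psi$ with these data the following hold. For all $t\ge T_0$, $$\|\psi(t,\cdot)\|_{L^2}\le C\,\widetilde{\mathcal D}_n(t)\big(\|\psi_0\|_{L^2\cap L^{1,1}}+\|\psi_1\|_{L^2\cap L^{1,1}}+\|\psi_2\|_{L^2\cap L^{1,1}}\big),$$ and there is $T\ge T_0$, which may depend on the data, such that for all $t\ge T$ $$c\,\widetilde{\mathcal D}_n(t)\,|P_{\psi_2}|\le\|\psi(t,\cdot)\|_{L^2}.$$ In particular, as $t\to\infty$, $\|\psi(t,\cdot)\|_{L^2}\to\infty$ if $n=3$ or $n=4$, and $\|\psi(t,\cdot)\|_{L^2}\to0$ if $n\ge5$. -/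

import Mathlib

open MeasureTheory Filter Topology Set
open scoped SchwartzMap Laplacian

noncomputable section

namespace Blackstock

/-- The Euclidean space `ℝⁿ`. -/
abbrev Space (n : ℕ) : Type := EuclideanSpace ℝ (Fin n)

/-- The space `L²(ℝⁿ)`. -/
abbrev L2 (n : ℕ) : Type := Lp ℂ 2 (volume : Measure (Space n))

/-- Membership in `L² ∩ L^{1,1}`, where `L^{1,1}` is the weighted `L¹` space of the functions `f`
with `∫ (1 + |x|) |f(x)| dx < ∞`. -/
def MemL2L11 {n : ℕ} (f : Space n → ℂ) : Prop :=
  MemLp f 2 volume ∧ Integrable (fun x => (1 + ‖x‖) * ‖f x‖) volume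

/-- The norm of `L² ∩ L^{1,1}`: the sum of `‖f‖_{L²}` and `∫ (1 + |x|) |f(x)| dx`. -/
def normL2L11 {n : ℕ} (f : Space n → ℂ) : ℝ :=
  (eLpNorm f 2 volume).toReal + ∫ x, (1 + ‖x‖) * ‖f x‖

/-- The modified diffusivity of sound `δ = b ν + (γ - 1) κ`. -/
def delta (κ γ b ν : ℝ) : ℝ := b * ν + (γ - 1) * κ

/-- The (bilinear) duality pairing `⟨f, φ⟩ = ∫ φ(x) f(x) dx` with a Schwartz function `φ`. -/
def pairing {n : ℕ} (f : Space n → ℂ) (φ : 𝓢(Space n, ℂ)) : ℂ := ∫ x, φ x * f x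

/-- The function `t ↦ ⟨ψ(t), φ⟩`. -/
def timePairing {n : ℕ} (ψ : ℝ → L2 n) (φ : 𝓢(Space n, ℂ)) : ℝ → ℂ :=
  fun t => pairing (ψ t) φ

/-- The `k`-th time derivative of `t ↦ ⟨ψ(t), φ⟩` on `[0, ∞)` (one-sided at `t = 0`), that is,
`⟨∂ₜᵏ ψ(t), φ⟩`. -/
def timeDeriv {n : ℕ} (k : ℕ) (ψ : ℝ → L2 n) (φ : 𝓢(Space n, ℂ)) : ℝ → ℂ :=
  iteratedDerivWithin k (timePairing ψ φ) (Ici 0)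

/-- `ψ` solves, on `[0, ∞) × ℝⁿ` and with data `ψ₀, ψ₁, ψ₂`, the Cauchy problem
`(∂ₜ - κ Δ)(ψ_tt - Δψ - δ Δψ_t) + κ (γ - 1)(b ν - κ) Δ² ψ_t = 0`,
`ψ(0) = ψ₀`, `ψ_t(0) = ψ₁`, `ψ_tt(0) = ψ₂`,
that is, `ψ ∈ C([0, ∞), L²)` and, as a function of time with values in the tempered distributions,
`ψ` is three times continuously differentiable and satisfies the equation and the initial
conditions. -/
structure IsSolution {n : ℕ} (κ γ b ν : ℝ) (ψ₀ ψ₁ ψ₂ : Space n → ℂ) (ψ : ℝ → L2 n) : Prop where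
  continuousOn : ContinuousOn ψ (Ici 0)
  contDiffOn : ∀ φ : 𝓢(Space n, ℂ), ContDiffOn ℝ 3 (timePairing ψ φ) (Ici 0)
  /-- The equation with the product of operators multiplied out,
  `ψ_ttt - (δ + κ) Δψ_tt - Δψ_t + (κ δ + κ (γ - 1)(b ν - κ)) Δ²ψ_t + κ Δ²ψ = 0`. -/
  equation : ∀ φ : 𝓢(Space n, ℂ), ∀ t : ℝ, 0 ≤ t →
    timeDeriv 3 ψ φ t
      - ((delta κ γ b ν + κ : ℝ) : ℂ) * timeDeriv 2 ψ (Δ φ) t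
      - timeDeriv 1 ψ (Δ φ) t
      + ((κ * delta κ γ b ν + κ * (γ - 1) * (b * ν - κ) : ℝ) : ℂ) * timeDeriv 1 ψ (Δ (Δ φ)) t
      + (κ : ℂ) * timePairing ψ (Δ (Δ φ)) t = 0
  initial_zero : (ψ 0 : Space n → ℂ) =ᵐ[volume] ψ₀
  initial_one : ∀ φ : 𝓢(Space n, ℂ), timeDeriv 1 ψ φ 0 = pairing ψ₁ φ
  initial_two : ∀ φ : 𝓢(Space n, ℂ), timeDeriv 2 ψ φ 0 = pairing ψ₂ φ

/-- The rate `t^{2 - n/2}` for `n ≤ 3`, `(ln t)^{1/2}` for `n = 4`, `t^{1 - n/4}` for `n ≥ 5`. -/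
def rate (n : ℕ) (t : ℝ) : ℝ :=
  if n ≤ 3 then t ^ (2 - (n : ℝ) / 2)
  else if n = 4 then (Real.log t) ^ (1 / 2 : ℝ)
  else t ^ (1 - (n : ℝ) / 4)

end Blackstock

end

/-! At frequency `r = 2π|ξ|` the equation becomes the ODE `y''' + α r² y'' + (r² + β r⁴) y' + κ r⁴ y
= 0` with `α = δ + κ` and `β = κγbν`. The Routh–Hurwitz condition `κ < α (1 + β r²)` follows from `κ
< α`, so every mode with `r > 0` is damped. A Lyapunov function makes this quantitative: the rate is
comparable to `r² / (1 + r²)`, that is, diffusive at low and uniformly exponential at high frequency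
(`IsMode.decay`).

The size of the solution comes from low frequencies. Up to a drift of relative size `O(r² t)`, the
part of the mode driven by `ψ₂` is `(1 - cos rt) / r²` times the transform of `ψ₂`, which is close
to `P = ∫ ψ₂`. Its square is at most of order `t⁴` for `r ≤ 1/t` and `r⁻⁴ exp(-c r² t)` beyond
(`norm_flow_le`). Against `r^(n-1) dr` this integrates to `t` for `n = 3` (from `r ~ 1/t`), to `log
t` for `n = 4` (all scales between `1/t` and `1/√t`), and to `t^(-(n-4)/2)` for `n ≥ 5` (from `r ~
1/√t`). These are the squares of the rate.

For the lower bound only frequencies with `cos rt ≤ 0` and `r² t ≤ ε` are kept: there `1 - cos rt ≥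
1` and the drift is harmless (`le_norm_flow`). Such frequencies still carry a fixed share of the
integral (`log_div_le_integral_inv_cos_nonpos`).

Since solutions are only distributional in time, it must also be shown that each one is given by the
explicit flow on the Fourier side (`IsSolution.fourierInv_ae_eq`). Plancherel then turns the
pointwise bounds into the theorem. -/

namespace Blackstock

/-! ### Energy estimates for a single mode. -/

/-- A solution of `y''' + α r² y'' + (r² + β r⁴) y' + κ r⁴ y = 0`, written as a first order system
for `y₀ = y`, `y₁ = y' / r`, `y₂ = y'' / r²`. -/
structure IsMode {F : Type*} [NormedAddCommGroup F] [NormedSpace ℝ F] (α β κ r : ℝ)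
    (y₀ y₁ y₂ : ℝ → F) : Prop where
  deriv_zero : ∀ t, HasDerivAt y₀ (r • y₁ t) t
  deriv_one : ∀ t, HasDerivAt y₁ (r • y₂ t) t
  deriv_two : ∀ t, HasDerivAt y₂
    (-(r • ((α * r) • y₂ t + (1 + β * r ^ 2) • y₁ t + (κ * r) • y₀ t))) t

/-- The Lyapunov function of the mode equation. -/
noncomputable def lyapunov (α β κ θ η r z q p : ℝ) : ℝ :=
  (p + θ * r * q) ^ 2 + (1 + (β + θ * (α - θ)) * r ^ 2) * q ^ 2 + 2 * κ * r * z * q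
    + θ * κ * r ^ 2 * z ^ 2
    + 2 * η * (z * p - q ^ 2 / 2 + α * r * z * q + (1 + β * r ^ 2) * z ^ 2 / 2)

lemma lyapunov_le {α β κ θ η : ℝ} (hκ : 0 ≤ κ) (hα0 : 0 ≤ α) (hβ : 0 ≤ β) (hη : 0 ≤ η)
    (hθ : 0 ≤ θ) (hαθ : 0 ≤ α - θ) (r z q p : ℝ) :
    lyapunov α β κ θ η r z q p ≤
      (2 + 2 * θ ^ 2 + 1 + (β + θ * (α - θ)) + κ + θ * κ + 2 * η * (1 + α + 1 + β)) *
        (p ^ 2 + (1 + r ^ 2) * (q ^ 2 + z ^ 2)) := by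
  have hrzq : 2 * (r * z * q) ≤ (1 + r ^ 2) * (q ^ 2 + z ^ 2) := by
    nlinarith [sq_nonneg (r * z - q), sq_nonneg (r * q), sq_nonneg z]
  have hzp : 2 * (z * p) ≤ p ^ 2 + (1 + r ^ 2) * (q ^ 2 + z ^ 2) := by
    nlinarith [sq_nonneg (z - p), sq_nonneg (r * q), sq_nonneg (r * z), sq_nonneg q]
  have hR : r ^ 2 * z ^ 2 ≤ (1 + r ^ 2) * (q ^ 2 + z ^ 2) := by
    nlinarith [sq_nonneg (r * q), sq_nonneg z, sq_nonneg q]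
  have hR' : r ^ 2 * q ^ 2 ≤ (1 + r ^ 2) * (q ^ 2 + z ^ 2) := by
    nlinarith [sq_nonneg (r * z), sq_nonneg z, sq_nonneg q]
  have hq : q ^ 2 ≤ (1 + r ^ 2) * (q ^ 2 + z ^ 2) := by
    nlinarith [sq_nonneg (r * z), sq_nonneg z, sq_nonneg (r * q)]
  have hz : z ^ 2 ≤ (1 + r ^ 2) * (q ^ 2 + z ^ 2) := by
    nlinarith [sq_nonneg (r * z), sq_nonneg q, sq_nonneg (r * q)]
  obtain ⟨S, hS⟩ : ∃ S, S = (1 + r ^ 2) * (q ^ 2 + z ^ 2) := ⟨_, rfl⟩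
  have hS0 : 0 ≤ S := by rw [hS]; positivity
  rw [← hS] at hrzq hzp hR hR' hq hz ⊢
  have hQ : S ≤ p ^ 2 + S := by nlinarith [sq_nonneg p]
  have t1 : (p + θ * r * q) ^ 2 ≤ (2 + 2 * θ ^ 2) * (p ^ 2 + S) := by
    nlinarith [sq_nonneg (p - θ * r * q), mul_le_mul_of_nonneg_left hR' (sq_nonneg θ),
      mul_nonneg (sq_nonneg θ) (sq_nonneg p)]
  have t2 : (1 + (β + θ * (α - θ)) * r ^ 2) * q ^ 2 ≤ (1 + (β + θ * (α - θ))) * (p ^ 2 + S) := by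
    have : 0 ≤ β + θ * (α - θ) := add_nonneg hβ (mul_nonneg hθ hαθ)
    nlinarith [mul_le_mul_of_nonneg_left (hR'.trans hQ) this]
  have t3 : 2 * κ * r * z * q ≤ κ * (p ^ 2 + S) := by
    nlinarith [mul_le_mul_of_nonneg_left (hrzq.trans hQ) hκ]
  have t4 : θ * κ * r ^ 2 * z ^ 2 ≤ θ * κ * (p ^ 2 + S) := by
    nlinarith [mul_le_mul_of_nonneg_left (hR.trans hQ) (mul_nonneg hθ hκ)]
  have t5 : z * p - q ^ 2 / 2 + α * r * z * q + (1 + β * r ^ 2) * z ^ 2 / 2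
      ≤ (1 + α + 1 + β) * (p ^ 2 + S) := by
    nlinarith [mul_le_mul_of_nonneg_left (hrzq.trans hQ) hα0,
      mul_le_mul_of_nonneg_left (hR.trans hQ) hβ, sq_nonneg q, mul_nonneg hα0 (hS0.trans hQ),
      mul_nonneg hβ (hS0.trans hQ)]
  have t6 := mul_le_mul_of_nonneg_left t5 (by positivity : 0 ≤ 2 * η)
  rw [lyapunov]
  linarith

-- The parameter `θ` is taken in the gap `κ < θ < α`: `θ < α` dissipates `p²`, and `θ > κ`
-- dissipates `q²`. The small multiplier `η` adds the missing dissipation of `z²`. Coercivity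
-- follows by completing squares.
set_option maxHeartbeats 800000 in
lemma lyapunov_bounds {α β κ : ℝ} (hκ : 0 < κ) (hα : κ < α) (hβ : 0 < β) :
    ∃ θ η c₁ c₂ C₂ : ℝ, 0 < c₁ ∧ 0 < c₂ ∧ 0 < C₂ ∧ ∀ r z q p : ℝ, 0 < r →
      c₂ * (p ^ 2 + (1 + r ^ 2) * (q ^ 2 + z ^ 2)) ≤ lyapunov α β κ θ η r z q p ∧
      lyapunov α β κ θ η r z q p ≤ C₂ * (p ^ 2 + (1 + r ^ 2) * (q ^ 2 + z ^ 2)) ∧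
      c₁ * (p ^ 2 + q ^ 2 + z ^ 2) ≤
        2 * (α - θ) * p ^ 2 + 2 * (θ * (1 + β * r ^ 2) - κ - η * α) * q ^ 2
          + 2 * η * κ * z ^ 2 := by
  obtain ⟨θ, hθκ, hθα⟩ := exists_between hα
  have hθ : 0 < θ := hκ.trans hθκ
  have hα0 : 0 < α := hκ.trans hα
  -- What is left of `q²` after the term `2κrzq` has been completed to `θκ(rz + q/θ)²`.
  obtain ⟨μ, hμdef⟩ : ∃ μ, μ = 1 - κ / θ := ⟨_, rfl⟩
  have hμ : 0 < μ := by rw [hμdef, sub_pos, div_lt_one hθ]; exact hθκ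
  have hκμ : κ / θ = 1 - μ := by rw [hμdef]; ring
  -- In this order, the four bounds keep half of `η z²` in the energy, keep `3μ/4` of `q²`, keep
  -- half of the `q²` dissipation `2(θ - κ)`, and absorb the cross term `2η(α - θ)rzq`.
  obtain ⟨η, hη, hη1⟩ : ∃ η : ℝ, 0 < η ∧ η < min (min (1 / 4) (μ / 4))
      (min ((θ - κ) / 2 / α) (μ / 4 / (2 * (α - θ) ^ 2 / β))) := by
    apply exists_between
    have : 0 < θ - κ := by linarith
    have : 0 < α - θ := by linarith
    positivity
  simp only [lt_min_iff] at hη1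
  obtain ⟨⟨hη1, hη2⟩, hη3, hη4⟩ := hη1
  have hαθ : 0 < α - θ := by linarith
  rw [lt_div_iff₀ hα0] at hη3
  rw [lt_div_iff₀ (by positivity)] at hη4
  -- Only a fraction `k` of `P²` is used to recover `p²` from `P = p + θrq`, so that the cost in
  -- `r²q²` stays below `β/2`.
  obtain ⟨k, hk, hk1⟩ : ∃ k : ℝ, 0 < k ∧ k < min 1 (β / θ ^ 2) := by
    apply exists_between; positivity
  simp only [lt_min_iff] at hk1
  obtain ⟨hk1, hk2⟩ := hk1
  rw [lt_div_iff₀ (by positivity)] at hk2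
  obtain ⟨c₂, hc₂, hc₂'⟩ : ∃ c : ℝ, 0 < c ∧ c < min (min (k / 4) (μ / 2))
      (min (β / 2) (min (η / 2) (η * β / 2))) := by
    apply exists_between; positivity
  simp only [lt_min_iff] at hc₂'
  obtain ⟨c₁, hc₁, hc₁'⟩ : ∃ c : ℝ, 0 < c ∧ c < min (2 * (α - θ)) (min (θ - κ) (2 * η * κ)) := by
    apply exists_between
    have : 0 < θ - κ := by linarith
    positivity
  simp only [lt_min_iff] at hc₁'
  refine ⟨θ, η, c₁, c₂, 2 + 2 * θ ^ 2 + 1 + (β + θ * (α - θ)) + κ + θ * κ + 2 * η * (1 + α + 1 + β),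
    hc₁, hc₂, by positivity, fun r z q p hr => ⟨?_, ?_, ?_⟩⟩
  · obtain ⟨P, hP⟩ : ∃ P, P = p + θ * r * q := ⟨_, rfl⟩
    have hp : p = P - θ * r * q := by rw [hP]; ring
    have hid : lyapunov α β κ θ η r z q p = P ^ 2 / 2 + (P + 2 * η * z) ^ 2 / 2
        + θ * κ * (r * z + q / θ) ^ 2
        + (μ - η + (β + θ * (α - θ)) * r ^ 2) * q ^ 2 + (η - 2 * η ^ 2) * z ^ 2
        + 2 * η * (α - θ) * r * z * q + η * β * r ^ 2 * z ^ 2 := by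
      have h1 : θ * κ * (r * z + q / θ) ^ 2 =
          θ * κ * r ^ 2 * z ^ 2 + 2 * κ * r * z * q + (κ / θ) * q ^ 2 := by
        field_simp
        ring
      rw [h1, hκμ, lyapunov, ← hP, hp]
      ring
    have h2 : -(η * β / 2 * r ^ 2 * z ^ 2 + μ / 4 * q ^ 2) ≤ 2 * η * (α - θ) * r * z * q := by
      have h3 : 0 ≤ η * β / 2 * (r * z + 2 * (α - θ) / β * q) ^ 2 := by positivity
      have h4 : η * β / 2 * (r * z + 2 * (α - θ) / β * q) ^ 2 = η * β / 2 * r ^ 2 * z ^ 2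
          + 2 * η * (α - θ) * r * z * q + η * (2 * (α - θ) ^ 2 / β) * q ^ 2 := by
        field_simp
        ring
      nlinarith [mul_le_mul_of_nonneg_right hη4.le (sq_nonneg q)]
    have h5 : η / 2 * z ^ 2 ≤ (η - 2 * η ^ 2) * z ^ 2 := by
      apply mul_le_mul_of_nonneg_right _ (sq_nonneg z)
      nlinarith
    have h6 : (3 * μ / 4 + β * r ^ 2) * q ^ 2 ≤ (μ - η + (β + θ * (α - θ)) * r ^ 2) * q ^ 2 := by
      apply mul_le_mul_of_nonneg_right _ (sq_nonneg q)
      have : 0 ≤ θ * (α - θ) * r ^ 2 := by positivity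
      linarith
    have h7 : k / 4 * p ^ 2 - β / 2 * r ^ 2 * q ^ 2 ≤ P ^ 2 / 2 := by
      have h8 : p ^ 2 ≤ 2 * P ^ 2 + 2 * θ ^ 2 * r ^ 2 * q ^ 2 := by
        rw [hp]; nlinarith [sq_nonneg (P + θ * r * q)]
      have h9 : k * P ^ 2 ≤ P ^ 2 := by nlinarith [sq_nonneg P]
      have h10 : k * θ ^ 2 * (r ^ 2 * q ^ 2) ≤ β * (r ^ 2 * q ^ 2) := by gcongr
      nlinarith [mul_le_mul_of_nonneg_left h8 hk.le]
    have h11 : 0 ≤ θ * κ * (r * z + q / θ) ^ 2 := by positivity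
    have h12 : 0 ≤ (P + 2 * η * z) ^ 2 / 2 := by positivity
    have e1 : c₂ * p ^ 2 ≤ k / 4 * p ^ 2 := by gcongr; exact hc₂'.1.1.le
    have e2 : c₂ * q ^ 2 ≤ μ / 2 * q ^ 2 := by gcongr; exact hc₂'.1.2.le
    have e3 : c₂ * (r ^ 2 * q ^ 2) ≤ β / 2 * (r ^ 2 * q ^ 2) := by gcongr; exact hc₂'.2.1.le
    have e4 : c₂ * z ^ 2 ≤ η / 2 * z ^ 2 := by gcongr; exact hc₂'.2.2.1.le
    have e5 : c₂ * (r ^ 2 * z ^ 2) ≤ η * β / 2 * (r ^ 2 * z ^ 2) := by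
      gcongr; exact hc₂'.2.2.2.le
    rw [hid]
    linarith
  · exact lyapunov_le hκ.le hα0.le hβ.le hη.le hθ.le hαθ.le r z q p
  · have e1 : c₁ * p ^ 2 ≤ 2 * (α - θ) * p ^ 2 := by gcongr; exact hc₁'.1.le
    have e2 : c₁ * q ^ 2 ≤ 2 * (θ * (1 + β * r ^ 2) - κ - η * α) * q ^ 2 := by
      gcongr
      have : 0 ≤ θ * β * r ^ 2 := by positivity
      linarith [hc₁'.2.1]
    have e3 : c₁ * z ^ 2 ≤ 2 * η * κ * z ^ 2 := by gcongr; exact hc₁'.2.2.le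
    linarith

lemma le_exp_mul_of_deriv_le {f f' : ℝ → ℝ} {k : ℝ} (hf : ∀ t, HasDerivAt f (f' t) t)
    (h : ∀ t, f' t ≤ -k * f t) {t : ℝ} (ht : 0 ≤ t) : f t ≤ Real.exp (-(k * t)) * f 0 := by
  have hg : ∀ s, HasDerivAt (fun s => Real.exp (k * s) * f s)
      (Real.exp (k * s) * (k * 1) * f s + Real.exp (k * s) * f' s) s := fun s =>
    (((hasDerivAt_id s).const_mul k).exp).mul (hf s)
  have hanti : Antitone fun s => Real.exp (k * s) * f s := by
    apply antitone_of_deriv_nonpos (fun s => (hg s).differentiableAt)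
    intro s
    rw [(hg s).deriv]
    nlinarith [h s, Real.exp_pos (k * s), mul_le_mul_of_nonneg_left (h s) (Real.exp_pos (k * s)).le]
  have := hanti ht
  simp only [mul_zero, Real.exp_zero, one_mul] at this
  rw [Real.exp_neg, ← div_eq_inv_mul, le_div_iff₀ (Real.exp_pos _)]
  linarith

/-- The dissipation is at least `c₁r²(p² + q² + z²)`, while the energy carries the weight `1 + r²`
on `q²` and `z²`. Their quotient gives the rate `r² / (1 + r²)`, and Grönwall concludes. -/
lemma IsMode.real_decay {α β κ : ℝ} (hκ : 0 < κ) (hα : κ < α) (hβ : 0 < β) :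
    ∃ c C : ℝ, 0 < c ∧ 0 < C ∧ ∀ r : ℝ, 0 < r → ∀ y₀ y₁ y₂ : ℝ → ℝ, IsMode α β κ r y₀ y₁ y₂ →
      ∀ t, 0 ≤ t → y₂ t ^ 2 + (1 + r ^ 2) * (y₁ t ^ 2 + y₀ t ^ 2) ≤
        C * Real.exp (-(c * (r ^ 2 / (1 + r ^ 2)) * t)) *
          (y₂ 0 ^ 2 + (1 + r ^ 2) * (y₁ 0 ^ 2 + y₀ 0 ^ 2)) := by
  obtain ⟨θ, η, c₁, c₂, C₂, hc₁, hc₂, hC₂, H⟩ := lyapunov_bounds hκ hα hβ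
  refine ⟨c₁ / C₂, C₂ / c₂, by positivity, by positivity, fun r hr y₀ y₁ y₂ hy t ht => ?_⟩
  have hd : ∀ s, HasDerivAt (fun s => lyapunov α β κ θ η r (y₀ s) (y₁ s) (y₂ s))
      (-r ^ 2 * (2 * (α - θ) * y₂ s ^ 2 + 2 * (θ * (1 + β * r ^ 2) - κ - η * α) * y₁ s ^ 2
          + 2 * η * κ * y₀ s ^ 2)) s := by
    intro s
    have h0 := hy.deriv_zero s
    have h1 := hy.deriv_one s
    have h2 := hy.deriv_two s
    simp only [smul_eq_mul] at h0 h1 h2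
    have := ((((h2.add (h1.const_mul (θ * r))).pow 2).add
      ((h1.pow 2).const_mul (1 + (β + θ * (α - θ)) * r ^ 2))).add
      ((h0.const_mul (2 * κ * r)).mul h1)).add ((h0.pow 2).const_mul (θ * κ * r ^ 2))
    have := this.add ((((h0.mul h2).sub ((h1.pow 2).div_const 2)).add
      ((h0.const_mul (α * r)).mul h1)).add
      (((h0.pow 2).const_mul (1 + β * r ^ 2)).div_const 2) |>.const_mul (2 * η))
    refine (this.congr_deriv ?_).congr_of_eventuallyEq (Eventually.of_forall fun x => ?_)
    · simp
      ring
    · simp [lyapunov]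
  have hle : ∀ s, -r ^ 2 * (2 * (α - θ) * y₂ s ^ 2
      + 2 * (θ * (1 + β * r ^ 2) - κ - η * α) * y₁ s ^ 2 + 2 * η * κ * y₀ s ^ 2) ≤
      -(c₁ / C₂ * (r ^ 2 / (1 + r ^ 2))) * lyapunov α β κ θ η r (y₀ s) (y₁ s) (y₂ s) := by
    intro s
    obtain ⟨-, H2, H3⟩ := H r (y₀ s) (y₁ s) (y₂ s) hr
    have e1 : c₁ / C₂ * (r ^ 2 / (1 + r ^ 2)) * lyapunov α β κ θ η r (y₀ s) (y₁ s) (y₂ s) ≤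
        c₁ / C₂ * (r ^ 2 / (1 + r ^ 2)) *
          (C₂ * (y₂ s ^ 2 + (1 + r ^ 2) * (y₁ s ^ 2 + y₀ s ^ 2))) := by gcongr
    have e2 : c₁ / C₂ * (r ^ 2 / (1 + r ^ 2)) *
          (C₂ * (y₂ s ^ 2 + (1 + r ^ 2) * (y₁ s ^ 2 + y₀ s ^ 2))) =
        c₁ * r ^ 2 * (y₂ s ^ 2 / (1 + r ^ 2) + (y₁ s ^ 2 + y₀ s ^ 2)) := by
      field_simp
    have e3 : y₂ s ^ 2 / (1 + r ^ 2) ≤ y₂ s ^ 2 :=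
      div_le_self (sq_nonneg _) (by nlinarith [sq_nonneg r])
    have e4 : c₁ * r ^ 2 * (y₂ s ^ 2 / (1 + r ^ 2) + (y₁ s ^ 2 + y₀ s ^ 2)) ≤
        c₁ * r ^ 2 * (y₂ s ^ 2 + (y₁ s ^ 2 + y₀ s ^ 2)) := by gcongr
    nlinarith [mul_le_mul_of_nonneg_left H3 (sq_nonneg r)]
  have hfin := le_exp_mul_of_deriv_le hd hle ht
  have H1 := (H r (y₀ t) (y₁ t) (y₂ t) hr).1
  have H2 := mul_le_mul_of_nonneg_left (H r (y₀ 0) (y₁ 0) (y₂ 0) hr).2.1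
    (Real.exp_pos (-(c₁ / C₂ * (r ^ 2 / (1 + r ^ 2)) * t))).le
  have H4 := H1.trans (hfin.trans H2)
  rw [mul_comm c₂, ← le_div_iff₀ hc₂] at H4
  refine H4.trans_eq ?_
  ring

variable {F G : Type*} [NormedAddCommGroup F] [NormedSpace ℝ F] [NormedAddCommGroup G]
  [NormedSpace ℝ G]

lemma IsMode.map {α β κ r : ℝ} {y₀ y₁ y₂ : ℝ → F} (hy : IsMode α β κ r y₀ y₁ y₂) (L : F →L[ℝ] G) :
    IsMode α β κ r (fun t => L (y₀ t)) (fun t => L (y₁ t)) (fun t => L (y₂ t)) where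
  deriv_zero t := by
    simpa using! L.hasFDerivAt.comp_hasDerivAt t (hy.deriv_zero t)
  deriv_one t := by
    simpa using! L.hasFDerivAt.comp_hasDerivAt t (hy.deriv_one t)
  deriv_two t := by
    simpa only [map_neg, map_smul, map_add] using!
      L.hasFDerivAt.comp_hasDerivAt t (hy.deriv_two t)

lemma IsMode.decay {α β κ : ℝ} (hκ : 0 < κ) (hα : κ < α) (hβ : 0 < β) :
    ∃ c C : ℝ, 0 < c ∧ 0 < C ∧ ∀ r : ℝ, 0 < r → ∀ y₀ y₁ y₂ : ℝ → ℂ, IsMode α β κ r y₀ y₁ y₂ →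
      ∀ t, 0 ≤ t → ‖y₂ t‖ ^ 2 + (1 + r ^ 2) * (‖y₁ t‖ ^ 2 + ‖y₀ t‖ ^ 2) ≤
        C * Real.exp (-(c * (r ^ 2 / (1 + r ^ 2)) * t)) *
          (‖y₂ 0‖ ^ 2 + (1 + r ^ 2) * (‖y₁ 0‖ ^ 2 + ‖y₀ 0‖ ^ 2)) := by
  obtain ⟨c, C, hc, hC, H⟩ := IsMode.real_decay hκ hα hβ
  refine ⟨c, C, hc, hC, fun r hr y₀ y₁ y₂ hy t ht => ?_⟩
  have h1 := H r hr _ _ _ (hy.map Complex.reCLM) t ht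
  have h2 := H r hr _ _ _ (hy.map Complex.imCLM) t ht
  simp only [Complex.reCLM_apply, Complex.imCLM_apply] at h1 h2
  simp only [Complex.sq_norm, Complex.normSq_apply]
  linarith

lemma IsMode.bounded {α β κ : ℝ} (hκ : 0 < κ) (hα : κ < α) (hβ : 0 < β) :
    ∃ K : ℝ, 0 < K ∧ ∀ r : ℝ, 0 < r → r ≤ 1 → ∀ y₀ y₁ y₂ : ℝ → ℂ, IsMode α β κ r y₀ y₁ y₂ →
      ∀ t, 0 ≤ t → ‖y₀ t‖ ≤ K * (‖y₀ 0‖ + ‖y₁ 0‖ + ‖y₂ 0‖) ∧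
        ‖y₁ t‖ ≤ K * (‖y₀ 0‖ + ‖y₁ 0‖ + ‖y₂ 0‖) ∧
        ‖y₂ t‖ ≤ K * (‖y₀ 0‖ + ‖y₁ 0‖ + ‖y₂ 0‖) := by
  obtain ⟨c, C, hc, hC, H⟩ := IsMode.decay hκ hα hβ
  refine ⟨Real.sqrt (2 * C), by positivity, fun r hr hr1 y₀ y₁ y₂ hy t ht => ?_⟩
  have h := H r hr y₀ y₁ y₂ hy t ht
  have he : Real.exp (-(c * (r ^ 2 / (1 + r ^ 2)) * t)) ≤ 1 := by
    rw [Real.exp_le_one_iff]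
    have : 0 ≤ c * (r ^ 2 / (1 + r ^ 2)) * t := by positivity
    linarith
  have hS : ‖y₂ 0‖ ^ 2 + (1 + r ^ 2) * (‖y₁ 0‖ ^ 2 + ‖y₀ 0‖ ^ 2) ≤
      2 * (‖y₀ 0‖ + ‖y₁ 0‖ + ‖y₂ 0‖) ^ 2 := by
    have h1 : (1 + r ^ 2) * (‖y₁ 0‖ ^ 2 + ‖y₀ 0‖ ^ 2) ≤ 2 * (‖y₁ 0‖ ^ 2 + ‖y₀ 0‖ ^ 2) := by
      gcongr
      nlinarith
    have e1 := mul_nonneg (norm_nonneg (y₀ 0)) (norm_nonneg (y₁ 0))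
    have e2 := mul_nonneg (norm_nonneg (y₀ 0)) (norm_nonneg (y₂ 0))
    have e3 := mul_nonneg (norm_nonneg (y₁ 0)) (norm_nonneg (y₂ 0))
    nlinarith [sq_nonneg ‖y₂ 0‖]
  have hb : C * Real.exp (-(c * (r ^ 2 / (1 + r ^ 2)) * t)) *
      (‖y₂ 0‖ ^ 2 + (1 + r ^ 2) * (‖y₁ 0‖ ^ 2 + ‖y₀ 0‖ ^ 2)) ≤
      (Real.sqrt (2 * C) * (‖y₀ 0‖ + ‖y₁ 0‖ + ‖y₂ 0‖)) ^ 2 := by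
    calc _ ≤ C * 1 * (2 * (‖y₀ 0‖ + ‖y₁ 0‖ + ‖y₂ 0‖) ^ 2) := by gcongr
      _ = _ := by rw [mul_pow, Real.sq_sqrt (by positivity)]; ring
  have hp : 0 ≤ r ^ 2 * (‖y₁ t‖ ^ 2 + ‖y₀ t‖ ^ 2) := by positivity
  refine ⟨?_, ?_, ?_⟩ <;>
  · apply le_of_sq_le_sq _ (by positivity)
    nlinarith [sq_nonneg ‖y₀ t‖, sq_nonneg ‖y₁ t‖, sq_nonneg ‖y₂ t‖]

lemma norm_sub_le_of_hasDerivAt {f f' : ℝ → ℂ} {B t : ℝ} (hf : ∀ s, HasDerivAt f (f' s) s)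
    (hB : ∀ s, 0 ≤ s → s ≤ t → ‖f' s‖ ≤ B) (ht : 0 ≤ t) : ‖f t - f 0‖ ≤ B * t := by
  simpa using norm_image_sub_le_of_norm_deriv_le_segment' (f := f) (f' := f')
    (fun s _ => (hf s).hasDerivWithinAt) (fun s hs => hB s hs.1 hs.2.le) t ⟨ht, le_rfl⟩

/-- Integrating the uniform bounds twice puts a factor `(rt)²` in front of `y₂(0)`. In the original
unknown `y₂(0)` is `r⁻²` times the datum, so the singularity at `r = 0` is traded for `t²`. -/
lemma IsMode.short_time {α β κ : ℝ} (hκ : 0 < κ) (hα : κ < α) (hβ : 0 < β) :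
    ∃ K : ℝ, 0 < K ∧ ∀ r : ℝ, 0 < r → r ≤ 1 → ∀ y₀ y₁ y₂ : ℝ → ℂ, IsMode α β κ r y₀ y₁ y₂ →
      ∀ t, 0 ≤ t → ‖y₀ t‖ ≤ ‖y₀ 0‖ + r * t * ‖y₁ 0‖ +
        K * (r * t) ^ 2 * (‖y₀ 0‖ + ‖y₁ 0‖ + ‖y₂ 0‖) := by
  obtain ⟨K, hK, H⟩ := IsMode.bounded hκ hα hβ
  refine ⟨K, hK, fun r hr hr1 y₀ y₁ y₂ hy t ht => ?_⟩
  obtain ⟨S, hS⟩ : ∃ S, S = ‖y₀ 0‖ + ‖y₁ 0‖ + ‖y₂ 0‖ := ⟨_, rfl⟩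
  have hS0 : 0 ≤ S := by rw [hS]; positivity
  have h1 : ∀ s, 0 ≤ s → s ≤ t → ‖y₁ s‖ ≤ ‖y₁ 0‖ + r * (K * S) * t := by
    intro s hs hst
    have := norm_sub_le_of_hasDerivAt (B := r * (K * S)) hy.deriv_one (fun u hu _ => by
      rw [norm_smul, Real.norm_of_nonneg hr.le, hS]
      gcongr
      exact (H r hr hr1 y₀ y₁ y₂ hy u hu).2.2) hs
    have h2 : r * (K * S) * s ≤ r * (K * S) * t := by gcongr
    linarith [norm_le_norm_add_norm_sub' (y₁ s) (y₁ 0)]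
  have h2 := norm_sub_le_of_hasDerivAt (B := r * (‖y₁ 0‖ + r * (K * S) * t)) hy.deriv_zero
    (fun u hu hut => by
      rw [norm_smul, Real.norm_of_nonneg hr.le]
      gcongr
      exact h1 u hu hut) ht
  rw [← hS]
  have := norm_le_norm_add_norm_sub' (y₀ t) (y₀ 0)
  linarith

/-- Without the `O(r²)` terms, `y₀ + y₂` is conserved and `(y₁, y₂)` rotates by the angle `rt`, so
`y₀(t) = y₀(0) + sin(rt) y₁(0) + (1 - cos rt) y₂(0)`. The neglected terms add up to `O(r² t)`, and
`cos rt ≤ 0` makes the coefficient of `y₂(0)` at least one. -/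
lemma IsMode.lower {α β κ : ℝ} (hκ : 0 < κ) (hα : κ < α) (hβ : 0 < β) :
    ∃ K : ℝ, 0 < K ∧ ∀ r : ℝ, 0 < r → r ≤ 1 → ∀ y₀ y₁ y₂ : ℝ → ℂ, IsMode α β κ r y₀ y₁ y₂ →
      ∀ t, 0 ≤ t → Real.cos (r * t) ≤ 0 → ‖y₂ 0‖ - ‖y₀ 0‖ - ‖y₁ 0‖
        - K * (r ^ 2 * t) * (‖y₀ 0‖ + ‖y₁ 0‖ + ‖y₂ 0‖) ≤ ‖y₀ t‖ := by
  obtain ⟨K, hK, H⟩ := IsMode.bounded hκ hα hβ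
  have hα0 : 0 < α := hκ.trans hα
  refine ⟨3 * ((α + β + κ) * K), by positivity, fun r hr hr1 y₀ y₁ y₂ hy t ht hcos => ?_⟩
  obtain ⟨S, hS⟩ : ∃ S, S = ‖y₀ 0‖ + ‖y₁ 0‖ + ‖y₂ 0‖ := ⟨_, rfl⟩
  have hS0 : 0 ≤ S := by rw [hS]; positivity
  -- The defect `y₂' + r y₁`, of size `O(r²)`. It drives both the conserved sum and the rotated-back
  -- coordinates.
  obtain ⟨g, hg⟩ : ∃ g : ℝ → ℂ, g = fun s =>
      -(r • ((α * r) • y₂ s + (1 + β * r ^ 2) • y₁ s + (κ * r) • y₀ s)) + r • y₁ s := ⟨_, rfl⟩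
  have hgb : ∀ s, 0 ≤ s → s ≤ t → ‖g s‖ ≤ (α + β + κ) * K * r ^ 2 * S := by
    intro s hs _
    obtain ⟨b0, b1, b2⟩ := H r hr hr1 y₀ y₁ y₂ hy s hs
    rw [← hS] at b0 b1 b2
    have e : g s = -((r ^ 2) • (α • y₂ s + (β * r) • y₁ s + κ • y₀ s)) := by
      rw [hg]; module
    rw [e, norm_neg, norm_smul, Real.norm_of_nonneg (by positivity)]
    have : ‖α • y₂ s + (β * r) • y₁ s + κ • y₀ s‖ ≤ α * (K * S) + (β * 1) * (K * S) + κ * (K * S) := by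
      refine (norm_add₃_le).trans ?_
      simp only [norm_smul, Real.norm_of_nonneg hα0.le, Real.norm_of_nonneg hκ.le,
        Real.norm_of_nonneg (by positivity : 0 ≤ β * r)]
      gcongr
    nlinarith [mul_le_mul_of_nonneg_left this (sq_nonneg r)]
  have hv : ∀ s, HasDerivAt (fun s => y₂ s + y₀ s) (g s) s := fun s => by
    rw [hg]; exact (hy.deriv_two s).add (hy.deriv_zero s)
  have hrt : ∀ s : ℝ, HasDerivAt (fun s : ℝ => r * s) r s := fun s => by
    simpa using (hasDerivAt_id s).const_mul r
  have hp : ∀ s, HasDerivAt (fun s => Real.cos (r * s) • y₂ s + Real.sin (r * s) • y₁ s)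
      (Real.cos (r * s) • g s) s := fun s => by
    refine (((hrt s).cos.smul (hy.deriv_two s)).add
      ((hrt s).sin.smul (hy.deriv_one s))).congr_deriv ?_
    rw [hg]
    module
  have hq : ∀ s, HasDerivAt (fun s => Real.cos (r * s) • y₁ s - Real.sin (r * s) • y₂ s)
      (-(Real.sin (r * s) • g s)) s := fun s => by
    refine (((hrt s).cos.smul (hy.deriv_one s)).sub
      ((hrt s).sin.smul (hy.deriv_two s))).congr_deriv ?_
    rw [hg]
    module
  have bv := norm_sub_le_of_hasDerivAt hv hgb ht
  have bp := norm_sub_le_of_hasDerivAt hp (fun s hs hst => by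
    rw [norm_smul]
    exact (mul_le_of_le_one_left (norm_nonneg _) (Real.abs_cos_le_one _)).trans
      (hgb s hs hst)) ht
  have bq := norm_sub_le_of_hasDerivAt hq (fun s hs hst => by
    rw [norm_neg, norm_smul]
    exact (mul_le_of_le_one_left (norm_nonneg _) (Real.abs_sin_le_one _)).trans
      (hgb s hs hst)) ht
  simp only [mul_zero, Real.cos_zero, Real.sin_zero, one_smul, zero_smul, add_zero, sub_zero]
    at bp bq
  obtain ⟨C, hC⟩ : ∃ C, C = Real.cos (r * t) := ⟨_, rfl⟩
  obtain ⟨D, hD⟩ : ∃ D, D = Real.sin (r * t) := ⟨_, rfl⟩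
  have hC1 : |C| ≤ 1 := hC ▸ Real.abs_cos_le_one _
  have hD1 : |D| ≤ 1 := hD ▸ Real.abs_sin_le_one _
  have hCD : C ^ 2 + D ^ 2 = 1 := by rw [hC, hD]; exact Real.cos_sq_add_sin_sq _
  rw [← hC, ← hD] at bp bq
  rw [← hC] at hcos
  -- The rotation is inverted to express `y₂(t)` through the almost conserved quantities.
  have key : (1 - C) • y₂ 0 = y₀ t - y₀ 0 - D • y₁ 0 - (y₂ t + y₀ t - (y₂ 0 + y₀ 0))
      + C • (C • y₂ t + D • y₁ t - y₂ 0) - D • (C • y₁ t - D • y₂ t - y₁ 0) := by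
    have : y₂ t = (C ^ 2 + D ^ 2) • y₂ t := by rw [hCD, one_smul]
    linear_combination (norm := module) this
  have h1 : ‖y₂ 0‖ ≤ ‖(1 - C) • y₂ 0‖ := by
    rw [norm_smul]
    apply le_mul_of_one_le_left (norm_nonneg _)
    rw [Real.norm_of_nonneg] <;> linarith
  have hsm : ∀ (E : ℝ) (z : ℂ), |E| ≤ 1 → ‖E • z‖ ≤ ‖z‖ := fun E z hE => by
    rw [norm_smul]; exact mul_le_of_le_one_left (norm_nonneg _) hE
  have h2 : ‖(1 - C) • y₂ 0‖ ≤ ‖y₀ t‖ + ‖y₀ 0‖ + ‖y₁ 0‖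
      + 3 * ((α + β + κ) * K * r ^ 2 * S * t) := by
    rw [key]
    have n1 := norm_sub_le (y₀ t - y₀ 0 - D • y₁ 0 - (y₂ t + y₀ t - (y₂ 0 + y₀ 0))
      + C • (C • y₂ t + D • y₁ t - y₂ 0)) (D • (C • y₁ t - D • y₂ t - y₁ 0))
    have n2 := norm_add_le (y₀ t - y₀ 0 - D • y₁ 0 - (y₂ t + y₀ t - (y₂ 0 + y₀ 0)))
      (C • (C • y₂ t + D • y₁ t - y₂ 0))
    have n3 := norm_sub_le (y₀ t - y₀ 0 - D • y₁ 0) (y₂ t + y₀ t - (y₂ 0 + y₀ 0))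
    have n4 := norm_sub_le (y₀ t - y₀ 0) (D • y₁ 0)
    have n5 := norm_sub_le (y₀ t) (y₀ 0)
    have m1 := hsm D (C • y₁ t - D • y₂ t - y₁ 0) hD1
    have m2 := hsm C (C • y₂ t + D • y₁ t - y₂ 0) hC1
    have m3 := hsm D (y₁ 0) hD1
    linarith
  rw [← hS]
  linarith

/-! ### The flow at a fixed frequency. -/

/-- The matrix of the equation `y''' + α m y'' + (m + β m²) y' + κ m² y = 0` as a first order
system for `(y, y', y'')`. -/
noncomputable def generator (α β κ m : ℝ) : (ℂ × ℂ × ℂ) →L[ℝ] (ℂ × ℂ × ℂ) :=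
  let p₀ := ContinuousLinearMap.fst ℝ ℂ (ℂ × ℂ)
  let p₁ := (ContinuousLinearMap.fst ℝ ℂ ℂ).comp (ContinuousLinearMap.snd ℝ ℂ (ℂ × ℂ))
  let p₂ := (ContinuousLinearMap.snd ℝ ℂ ℂ).comp (ContinuousLinearMap.snd ℝ ℂ (ℂ × ℂ))
  p₁.prod (p₂.prod 0) + m • ((0 : _ →L[ℝ] ℂ).prod ((0 : _ →L[ℝ] ℂ).prod (-(α • p₂ + p₁))))
    + m ^ 2 • ((0 : _ →L[ℝ] ℂ).prod ((0 : _ →L[ℝ] ℂ).prod (-(β • p₁ + κ • p₀))))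

lemma generator_apply (α β κ m : ℝ) (v : ℂ × ℂ × ℂ) :
    generator α β κ m v = (v.2.1, v.2.2,
      -((α * m) • v.2.2 + (m + β * m ^ 2) • v.2.1 + (κ * m ^ 2) • v.1)) := by
  ext1
  · simp [generator]
  · ext1
    · simp [generator]
    · simp [generator]
      ring

lemma continuous_generator (α β κ : ℝ) : Continuous (generator α β κ) := by
  unfold generator
  fun_prop

/-- The solution at time `t` of the mode equation with data `v`. -/
noncomputable def flow (α β κ m t : ℝ) (v : ℂ × ℂ × ℂ) : ℂ × ℂ × ℂ :=
  NormedSpace.exp (t • generator α β κ m) v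

lemma continuous_flow (α β κ : ℝ) :
    Continuous fun x : ℝ × ℝ × (ℂ × ℂ × ℂ) => flow α β κ x.1 x.2.1 x.2.2 := by
  let _ : NormedAlgebra ℚ ((ℂ × ℂ × ℂ) →L[ℝ] (ℂ × ℂ × ℂ)) := NormedAlgebra.restrictScalars ℚ ℝ _
  have h : Continuous fun x : ℝ × ℝ × (ℂ × ℂ × ℂ) =>
      NormedSpace.exp (x.2.1 • generator α β κ x.1) :=
    (NormedSpace.exp_continuous (𝔸 := (ℂ × ℂ × ℂ) →L[ℝ] (ℂ × ℂ × ℂ))).comp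
      ((continuous_fst.comp continuous_snd).smul
        ((continuous_generator α β κ).comp continuous_fst))
  exact h.clm_apply (continuous_snd.comp continuous_snd)

lemma hasDerivAt_flow (α β κ m t : ℝ) (v : ℂ × ℂ × ℂ) :
    HasDerivAt (fun t => flow α β κ m t v) (generator α β κ m (flow α β κ m t v)) t := by
  have h := hasDerivAt_exp_smul_const' (𝕂 := ℝ) (generator α β κ m) t
  simpa [flow] using! h.clm_apply (hasDerivAt_const t v)

lemma flow_zero (α β κ m : ℝ) (v : ℂ × ℂ × ℂ) : flow α β κ m 0 v = v := by
  have h : (0 : ℝ) • generator α β κ m = 0 :=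
    ContinuousLinearMap.ext fun w => zero_smul ℝ (generator α β κ m w)
  rw [flow, h, NormedSpace.exp_zero]
  rfl

lemma hasDerivAt_flow_zero (α β κ m t : ℝ) (v : ℂ × ℂ × ℂ) :
    HasDerivAt (fun t => (flow α β κ m t v).1) (flow α β κ m t v).2.1 t := by
  simpa [generator_apply] using!
    (ContinuousLinearMap.fst ℝ ℂ (ℂ × ℂ)).hasFDerivAt.comp_hasDerivAt t (hasDerivAt_flow α β κ m t v)

lemma hasDerivAt_flow_one (α β κ m t : ℝ) (v : ℂ × ℂ × ℂ) :
    HasDerivAt (fun t => (flow α β κ m t v).2.1) (flow α β κ m t v).2.2 t := by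
  simpa [generator_apply] using!
    ((ContinuousLinearMap.fst ℝ ℂ ℂ).comp (ContinuousLinearMap.snd ℝ ℂ (ℂ × ℂ))).hasFDerivAt
      |>.comp_hasDerivAt t (hasDerivAt_flow α β κ m t v)

lemma hasDerivAt_flow_two (α β κ m t : ℝ) (v : ℂ × ℂ × ℂ) :
    HasDerivAt (fun t => (flow α β κ m t v).2.2)
      (-((α * m) • (flow α β κ m t v).2.2 + (m + β * m ^ 2) • (flow α β κ m t v).2.1
        + (κ * m ^ 2) • (flow α β κ m t v).1)) t := by
  have h := ((ContinuousLinearMap.snd ℝ ℂ ℂ).comp (ContinuousLinearMap.snd ℝ ℂ (ℂ × ℂ))).hasFDerivAt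
    |>.comp_hasDerivAt t (hasDerivAt_flow α β κ m t v)
  rw [generator_apply] at h
  exact h

/-- The rescaling divides the first and second derivatives by `r` and `r²`. This is where the data
acquire their low-frequency singularities. -/
lemma isMode_flow (α β κ : ℝ) {r : ℝ} (hr : 0 < r) (v : ℂ × ℂ × ℂ) :
    IsMode α β κ r (fun t => (flow α β κ (r ^ 2) t v).1)
      (fun t => r⁻¹ • (flow α β κ (r ^ 2) t v).2.1)
      (fun t => (r ^ 2)⁻¹ • (flow α β κ (r ^ 2) t v).2.2) where
  deriv_zero t := by
    simpa only [smul_inv_smul₀ hr.ne'] using hasDerivAt_flow_zero α β κ (r ^ 2) t v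
  deriv_one t := by
    refine ((hasDerivAt_flow_one α β κ (r ^ 2) t v).const_smul r⁻¹).congr_deriv ?_
    rw [smul_smul]
    congr 1
    field_simp
  deriv_two t := by
    refine ((hasDerivAt_flow_two α β κ (r ^ 2) t v).const_smul (r ^ 2)⁻¹).congr_deriv ?_
    match_scalars <;> field_simp

/-! ### Uniqueness for the equations tested against functions of bounded frequency. -/

lemma hasDerivAt_integral_mul {E : Type*} [TopologicalSpace E] [MeasurableSpace E]
    [OpensMeasurableSpace E] [SecondCountableTopology E] {μ : Measure E}
    [IsFiniteMeasureOnCompacts μ] {f f' : ℝ → E → ℂ} (hf : Continuous fun x : ℝ × E => f x.1 x.2)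
    (hf' : Continuous fun x : ℝ × E => f' x.1 x.2)
    (h : ∀ t ξ, HasDerivAt (fun t => f t ξ) (f' t ξ) t) {χ : E → ℂ} (hχ : Continuous χ)
    (hχc : HasCompactSupport χ) (t : ℝ) :
    HasDerivAt (fun t => ∫ ξ, χ ξ * f t ξ ∂μ) (∫ ξ, χ ξ * f' t ξ ∂μ) t := by
  obtain ⟨B, hB⟩ := (isCompact_Icc (a := t - 1) (b := t + 1)).prod hχc.isCompact
    |>.exists_bound_of_continuousOn hf'.continuousOn
  have hc : ∀ s, Continuous fun ξ => f s ξ := fun s => by fun_prop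
  have hc' : ∀ s, Continuous fun ξ => f' s ξ := fun s => by fun_prop
  refine (hasDerivAt_integral_of_dominated_loc_of_deriv_le (μ := μ)
    (F := fun t ξ => χ ξ * f t ξ) (F' := fun t ξ => χ ξ * f' t ξ) (x₀ := t)
    (s := Icc (t - 1) (t + 1)) (bound := fun ξ => ‖χ ξ‖ * B)
    (Icc_mem_nhds (by linarith) (by linarith)) ?_ ?_ ?_ ?_ ?_ ?_).2
  · exact Eventually.of_forall fun s => (hχ.mul (hc s)).aestronglyMeasurable
  · exact (hχ.mul (hc t)).integrable_of_hasCompactSupport hχc.mul_right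
  · exact (hχ.mul (hc' t)).aestronglyMeasurable
  · refine Eventually.of_forall fun ξ s hs => ?_
    rw [norm_mul]
    by_cases hξ : ξ ∈ tsupport χ
    · gcongr
      exact hB (s, ξ) ⟨hs, hξ⟩
    · simp [image_eq_zero_of_notMem_tsupport hξ]
  · exact (hχ.norm.mul continuous_const).integrable_of_hasCompactSupport hχc.norm.mul_right
  · exact Eventually.of_forall fun ξ s _ => (h s ξ).const_mul (χ ξ)

lemma norm_le_exp_of_norm_deriv_le_exp {f f' : ℝ → ℂ} {T C l : ℝ} (hl : 1 ≤ l) (hC : 0 ≤ C)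
    (hf : ∀ s, 0 ≤ s → HasDerivWithinAt f (f' s) (Ici 0) s) (h0 : f 0 = 0)
    (hf' : ∀ s, 0 ≤ s → s ≤ T → ‖f' s‖ ≤ C * Real.exp (l * s)) :
    ∀ s, 0 ≤ s → s ≤ T → ‖f s‖ ≤ C / l * Real.exp (l * s) := by
  intro s hs hsT
  have hl0 : 0 < l := by linarith
  refine image_norm_le_of_norm_deriv_right_le_deriv_boundary (a := 0) (b := T) (f := f) (f' := f')
    (B := fun s => C / l * Real.exp (l * s)) (B' := fun s => C * Real.exp (l * s)) ?_ ?_ ?_ ?_ ?_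
    ⟨hs, hsT⟩
  · exact fun u hu => ((hf u hu.1).continuousWithinAt).mono Icc_subset_Ici_self
  · exact fun u hu => (hf u hu.1).mono (Ici_subset_Ici.2 hu.1)
  · rw [h0]; simp; positivity
  · intro u
    refine ((((hasDerivAt_id u).const_mul l).exp).const_mul (C / l)).congr_deriv ?_
    simp only [id]
    field_simp
  · exact fun u hu => hf' u hu.1 hu.2.le

/-- Here `X` stands for test functions and `m` for multiplication by the symbol. The equation for
`χ` involves `m χ` and `m (m χ)`, so it never closes, but `m` enlarges sizes by at most `ρ`, as a
bounded operator would. Only `d₀` is bounded a priori, so the equation is integrated in the form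
`(d₂ χ + α d₁(mχ) + d₀(mχ) + β d₀(m²χ))' = -κ d₀(m²χ)`. In a norm weighted by `exp(ls)` each
integration gains `1/l`, and one full round halves the bound. -/
lemma eq_zero_of_mode_hierarchy {X : Type*} (m : X → X) (sz : X → ℝ) {α β κ ρ N T : ℝ} (hα : 0 ≤ α)
    (hβ : 0 ≤ β) (hκ : 0 ≤ κ) (hρ : 0 ≤ ρ) (hN : 0 ≤ N) (hsz : ∀ χ, 0 ≤ sz χ)
    (hm : ∀ χ, sz (m χ) ≤ ρ * sz χ) (d₀ d₁ d₂ : X → ℝ → ℂ)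
    (h₀ : ∀ χ s, 0 ≤ s → HasDerivWithinAt (d₀ χ) (d₁ χ s) (Ici 0) s)
    (h₁ : ∀ χ s, 0 ≤ s → HasDerivWithinAt (d₁ χ) (d₂ χ s) (Ici 0) s)
    (h₂ : ∀ χ s, 0 ≤ s → HasDerivWithinAt (d₂ χ)
      (-(α * d₂ (m χ) s + d₁ (m χ) s + β * d₁ (m (m χ)) s + κ * d₀ (m (m χ)) s)) (Ici 0) s)
    (i₀ : ∀ χ, d₀ χ 0 = 0) (i₁ : ∀ χ, d₁ χ 0 = 0) (i₂ : ∀ χ, d₂ χ 0 = 0)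
    (hb : ∀ χ s, 0 ≤ s → s ≤ T → ‖d₀ χ s‖ ≤ N * sz χ) (χ : X) {s : ℝ} (hs : 0 ≤ s) (hsT : s ≤ T) :
    d₀ χ s = 0 := by
  obtain ⟨a, ha⟩ : ∃ a, a = κ * ρ ^ 2 := ⟨_, rfl⟩
  have ha0 : 0 ≤ a := by rw [ha]; positivity
  obtain ⟨b, hbdef⟩ : ∃ b, b = a + ρ + β * ρ ^ 2 := ⟨_, rfl⟩
  have hb0 : 0 ≤ b := by rw [hbdef]; positivity
  obtain ⟨Λ, hΛdef⟩ : ∃ Λ, Λ = b + α * ρ := ⟨_, rfl⟩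
  have hΛ : 0 ≤ Λ := by rw [hΛdef]; positivity
  -- Gives `Λ / l ≤ 1/2` for the final contraction, and `l ≥ 1` so that the gains of the first two
  -- integrations can be discarded.
  obtain ⟨l, hldef⟩ : ∃ l, l = 2 * Λ + 1 := ⟨_, rfl⟩
  have hl : 1 ≤ l := by linarith
  have hmm : ∀ χ, sz (m (m χ)) ≤ ρ ^ 2 * sz χ := fun χ => by
    have := mul_le_mul_of_nonneg_left (hm χ) hρ
    have := hm (m χ)
    nlinarith
  have step : ∀ S : ℝ, 0 ≤ S →
      (∀ χ s, 0 ≤ s → s ≤ T → ‖d₀ χ s‖ ≤ S * sz χ * Real.exp (l * s)) →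
      ∀ χ s, 0 ≤ s → s ≤ T → ‖d₀ χ s‖ ≤ S / 2 * sz χ * Real.exp (l * s) := by
    intro S hS H χ
    have H1 : ∀ s, 0 ≤ s → s ≤ T → ‖d₀ (m χ) s‖ ≤ ρ * (S * sz χ * Real.exp (l * s)) := by
      intro s hs hsT
      refine (H (m χ) s hs hsT).trans ?_
      have : S * sz (m χ) * Real.exp (l * s) ≤ S * (ρ * sz χ) * Real.exp (l * s) := by
        gcongr; exact hm χ
      linarith
    have H2 : ∀ s, 0 ≤ s → s ≤ T → ‖d₀ (m (m χ)) s‖ ≤ ρ ^ 2 * (S * sz χ * Real.exp (l * s)) := by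
      intro s hs hsT
      refine (H (m (m χ)) s hs hsT).trans ?_
      have : S * sz (m (m χ)) * Real.exp (l * s) ≤ S * (ρ ^ 2 * sz χ) * Real.exp (l * s) := by
        gcongr; exact hmm χ
      linarith
    have hSz : 0 ≤ S * sz χ := mul_nonneg hS (hsz χ)
    have hdiv : ∀ {c : ℝ}, 0 ≤ c → ∀ s, c * (S * sz χ) / l * Real.exp (l * s) ≤
        c * (S * sz χ) * Real.exp (l * s) := fun {c} hc s => by
      gcongr
      exact div_le_self (by positivity) hl
    have hE := norm_le_exp_of_norm_deriv_le_exp (T := T) (C := a * (S * sz χ)) hl (by positivity)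
      (f := fun s => d₂ χ s + α * d₁ (m χ) s + d₀ (m χ) s + β * d₀ (m (m χ)) s)
      (f' := fun s => -(κ * d₀ (m (m χ)) s)) (fun s hs => by
        refine ((((h₂ χ s hs).add ((h₁ (m χ) s hs).const_mul (α : ℂ))).add (h₀ (m χ) s hs)).add
          ((h₀ (m (m χ)) s hs).const_mul (β : ℂ))).congr_deriv ?_
        ring) (by simp [i₀, i₁, i₂]) (fun s hs hsT => by
        rw [norm_neg, norm_mul, Complex.norm_real, Real.norm_of_nonneg hκ, ha]
        have := mul_le_mul_of_nonneg_left (H2 s hs hsT) hκ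
        linarith)
    have hF := norm_le_exp_of_norm_deriv_le_exp (T := T) (C := b * (S * sz χ)) hl (by positivity)
      (f := fun s => d₁ χ s + α * d₀ (m χ) s)
      (f' := fun s => (d₂ χ s + α * d₁ (m χ) s + d₀ (m χ) s + β * d₀ (m (m χ)) s)
        - d₀ (m χ) s - β * d₀ (m (m χ)) s) (fun s hs => by
        refine ((h₁ χ s hs).add ((h₀ (m χ) s hs).const_mul (α : ℂ))).congr_deriv ?_
        ring) (by simp [i₀, i₁]) (fun s hs hsT => by
        have n1 := norm_sub_le ((d₂ χ s + α * d₁ (m χ) s + d₀ (m χ) s + β * d₀ (m (m χ)) s)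
          - d₀ (m χ) s) (β * d₀ (m (m χ)) s)
        have n2 := norm_sub_le (d₂ χ s + α * d₁ (m χ) s + d₀ (m χ) s + β * d₀ (m (m χ)) s)
          (d₀ (m χ) s)
        have n3 : ‖(β : ℂ) * d₀ (m (m χ)) s‖ ≤ β * (ρ ^ 2 * (S * sz χ * Real.exp (l * s))) := by
          rw [norm_mul, Complex.norm_real, Real.norm_of_nonneg hβ]
          exact mul_le_mul_of_nonneg_left (H2 s hs hsT) hβ
        have n4 := (hE s hs hsT).trans (hdiv ha0 s)
        have n5 := H1 s hs hsT
        rw [hbdef]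
        linarith)
    have hD := norm_le_exp_of_norm_deriv_le_exp (T := T) (C := Λ * (S * sz χ)) hl (by positivity)
      (h₀ χ) (i₀ χ) (fun s hs hsT => by
        have n1 := norm_sub_le (d₁ χ s + α * d₀ (m χ) s) (α * d₀ (m χ) s)
        rw [add_sub_cancel_right] at n1
        have n3 : ‖(α : ℂ) * d₀ (m χ) s‖ ≤ α * (ρ * (S * sz χ * Real.exp (l * s))) := by
          rw [norm_mul, Complex.norm_real, Real.norm_of_nonneg hα]
          exact mul_le_mul_of_nonneg_left (H1 s hs hsT) hα
        have n4 := (hF s hs hsT).trans (hdiv hb0 s)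
        rw [hΛdef]
        linarith)
    intro s hs hsT
    refine (hD s hs hsT).trans ?_
    have : Λ * (S * sz χ) / l ≤ S / 2 * sz χ := by
      rw [div_le_iff₀ (by linarith), hldef]
      nlinarith
    gcongr
  have hall : ∀ k : ℕ, ∀ χ s, 0 ≤ s → s ≤ T →
      ‖d₀ χ s‖ ≤ N * (1 / 2) ^ k * sz χ * Real.exp (l * s) := by
    intro k
    induction k with
    | zero =>
      intro χ s hs hsT
      refine (hb χ s hs hsT).trans ?_
      rw [pow_zero, mul_one]
      exact le_mul_of_one_le_right (mul_nonneg hN (hsz χ)) (Real.one_le_exp (by positivity))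
    | succ k ih =>
      intro χ s hs hsT
      refine (step _ (by positivity) ih χ s hs hsT).trans_eq ?_
      ring
  have hlim : Tendsto (fun k : ℕ => N * (1 / 2 : ℝ) ^ k * sz χ * Real.exp (l * s)) atTop (𝓝 0) := by
    have := tendsto_pow_atTop_nhds_zero_of_lt_one (r := (1 / 2 : ℝ)) (by norm_num) (by norm_num)
    simpa using ((this.const_mul N).mul_const (sz χ)).mul_const (Real.exp (l * s))
  exact norm_le_zero_iff.1 (ge_of_tendsto' hlim fun k => hall k χ s hs hsT)

/-! ### The Fourier side: pairings, Plancherel and the symbol of the Laplacian. -/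

open scoped FourierTransform

variable {n : ℕ}

lemma MemL2L11.integrable {f : Space n → ℂ} (hf : MemL2L11 f) : Integrable f := by
  refine hf.2.mono' hf.1.1 (Eventually.of_forall fun x => ?_)
  nlinarith [norm_nonneg x, norm_nonneg (f x), mul_nonneg (norm_nonneg x) (norm_nonneg (f x))]

lemma continuous_fourierInv {f : Space n → ℂ} (hf : Integrable f) : Continuous (𝓕⁻ f) := by
  have h : Continuous (𝓕 f) :=
    VectorFourier.fourierIntegral_continuous Real.continuous_fourierChar continuous_inner hf
  have : 𝓕⁻ f = fun ξ => 𝓕 f (-ξ) := by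
    ext ξ; rw [Real.fourierInv_eq_fourier_neg]
  rw [this]
  exact h.comp continuous_neg

/-- Fubini in the Fourier kernel. The pairing is bilinear, so moving the transform to the other
factor keeps it an inverse transform; this is why `𝓕⁻` is used for solutions throughout. -/
lemma pairing_fourierInv_of_integrable {f : Space n → ℂ} (hf : Integrable f)
    (χ : 𝓢(Space n, ℂ)) : pairing f (𝓕⁻ χ) = ∫ ξ, χ ξ * 𝓕⁻ f ξ := by
  have h := VectorFourier.integral_fourierIntegral_smul_eq_flip (L := -innerₗ (Space n)) (μ := volume)
    (ν := volume) (f := χ) (g := f) Real.continuous_fourierChar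
    (continuous_inner (𝕜 := ℝ) (E := Space n)).neg χ.integrable hf
  have e1 : ∀ (g : Space n → ℂ), VectorFourier.fourierIntegral Real.fourierChar volume
      (-innerₗ (Space n)) g = 𝓕⁻ g := by
    intro g; ext ξ
    simp [VectorFourier.fourierIntegral, Real.fourierInv_eq]
  have e2 : ∀ (g : Space n → ℂ), VectorFourier.fourierIntegral Real.fourierChar volume
      (-innerₗ (Space n)).flip g = 𝓕⁻ g := by
    intro g; ext ξ
    simp [VectorFourier.fourierIntegral, Real.fourierInv_eq, real_inner_comm]
  rw [e1, e2] at h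
  simpa only [pairing, SchwartzMap.fourierInv_coe, smul_eq_mul] using h

lemma pairing_fourierInv (f : L2 n) (χ : 𝓢(Space n, ℂ)) :
    pairing f (𝓕⁻ χ) = pairing (𝓕⁻ f : L2 n) χ := by
  have h := congrArg (fun u => u χ) (Lp.fourierInv_toTemperedDistribution_eq f)
  simpa only [TemperedDistribution.fourierInv_apply, Lp.toTemperedDistribution_apply,
    smul_eq_mul, pairing] using h

/-- Multiplication by `|2πξ|²`. -/
noncomputable def mulSymbol : 𝓢(Space n, ℂ) →L[ℝ] 𝓢(Space n, ℂ) :=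
  SchwartzMap.smulLeftCLM ℂ (fun ξ : Space n => (2 * Real.pi * ‖ξ‖) ^ 2)

lemma mulSymbol_apply (χ : 𝓢(Space n, ℂ)) (ξ : Space n) :
    mulSymbol χ ξ = ((2 * Real.pi * ‖ξ‖) ^ 2 : ℝ) * χ ξ := by
  rw [mulSymbol, SchwartzMap.smulLeftCLM_apply_apply]
  · simp
  · simp_rw [mul_pow]
    fun_prop

lemma laplacian_fourierInv (χ : 𝓢(Space n, ℂ)) : Δ (𝓕⁻ χ) = -𝓕⁻ (mulSymbol χ) := by
  rw [SchwartzMap.laplacian_eq_fourierMultiplierCLM, SchwartzMap.fourierMultiplierCLM_apply,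
    FourierTransform.fourier_fourierInv_eq, neg_smul, ← FourierTransform.fourierInv_smul]
  congr 2
  ext ξ
  rw [mulSymbol_apply, smul_apply, SchwartzMap.smulLeftCLM_apply_apply (by fun_prop)]
  simp
  ring

lemma timePairing_neg (ψ : ℝ → L2 n) (φ : 𝓢(Space n, ℂ)) :
    timePairing ψ (-φ) = -timePairing ψ φ := by
  ext t
  simp [timePairing, pairing, integral_neg]

lemma timeDeriv_neg (k : ℕ) (ψ : ℝ → L2 n) (φ : 𝓢(Space n, ℂ)) (t : ℝ) :
    timeDeriv k ψ (-φ) t = -timeDeriv k ψ φ t := by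
  rw [timeDeriv, timePairing_neg, iteratedDerivWithin_neg]
  rfl

lemma hasDerivWithinAt_timeDeriv {ψ : ℝ → L2 n} {φ : 𝓢(Space n, ℂ)}
    (h : ContDiffOn ℝ 3 (timePairing ψ φ) (Ici 0)) {k : ℕ} (hk : k < 3) {t : ℝ} (ht : 0 ≤ t) :
    HasDerivWithinAt (timeDeriv k ψ φ) (timeDeriv (k + 1) ψ φ t) (Ici 0) t := by
  have hd := h.differentiableOn_iteratedDerivWithin (m := k) (by exact_mod_cast hk)
    (uniqueDiffOn_Ici 0)
  have := (hd t ht).hasDerivWithinAt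
  rwa [← iteratedDerivWithin_succ] at this

lemma integral_norm_sq_eq (f : L2 n) : ∫ x, ‖f x‖ ^ 2 = ‖f‖ ^ 2 := by
  have h := L2.inner_def (𝕜 := ℂ) f f
  simp only [inner_self_eq_norm_sq_to_K] at h
  apply Complex.ofReal_injective
  rw [← integral_complex_ofReal]
  push_cast
  exact h.symm

lemma integrable_norm_sq (f : L2 n) : Integrable (fun x => ‖f x‖ ^ 2) :=
  (memLp_two_iff_integrable_sq_norm (Lp.aestronglyMeasurable f)).1 (Lp.memLp f)

lemma ae_eq_of_pairing_eq (f : L2 n) {w : Space n → ℂ} (hw : Continuous w)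
    (h : ∀ χ : 𝓢(Space n, ℂ), HasCompactSupport χ → pairing f χ = ∫ ξ, χ ξ * w ξ) :
    (f : Space n → ℂ) =ᵐ[volume] w := by
  refine ae_eq_of_integral_contDiff_smul_eq ((Lp.memLp f).locallyIntegrable (by norm_num))
    hw.locallyIntegrable fun g hg hgc => ?_
  have hgs : HasCompactSupport fun x => (g x : ℂ) := hgc.comp_left Complex.ofReal_zero
  exact h (hgs.toSchwartzMap (Complex.ofRealCLM.contDiff.comp hg)) hgs

lemma norm_fourierInv_L2 (f : L2 n) : ‖(𝓕⁻ f : L2 n)‖ = ‖f‖ :=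
  (Lp.fourierTransformₗᵢ (Space n) ℂ).symm.norm_map f

/-- The inverse Fourier transform of the solution with data `ψ₀, ψ₁, ψ₂`, as a triple together with
its first and second time derivatives. -/
noncomputable def fourierSolution (α β κ : ℝ) (ψ₀ ψ₁ ψ₂ : Space n → ℂ) (t : ℝ) (ξ : Space n) :
    ℂ × ℂ × ℂ :=
  flow α β κ ((2 * Real.pi * ‖ξ‖) ^ 2) t (𝓕⁻ ψ₀ ξ, 𝓕⁻ ψ₁ ξ, 𝓕⁻ ψ₂ ξ)

lemma continuous_fourierSolution (α β κ : ℝ) {ψ₀ ψ₁ ψ₂ : Space n → ℂ} (h₀ : Integrable ψ₀)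
    (h₁ : Integrable ψ₁) (h₂ : Integrable ψ₂) :
    Continuous fun x : ℝ × Space n => fourierSolution α β κ ψ₀ ψ₁ ψ₂ x.1 x.2 := by
  have c₀ := continuous_fourierInv h₀
  have c₁ := continuous_fourierInv h₁
  have c₂ := continuous_fourierInv h₂
  have hm : Continuous fun x : ℝ × Space n =>
      ((2 * Real.pi * ‖x.2‖) ^ 2, x.1, (𝓕⁻ ψ₀ x.2, 𝓕⁻ ψ₁ x.2, 𝓕⁻ ψ₂ x.2)) := by fun_prop
  exact (continuous_flow α β κ).comp hm

/-- Test functions supported in the ball of radius `R`, with a bound for their absolute value. -/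
def BoundedTest (n : ℕ) (R : ℝ) : Type :=
  {p : 𝓢(Space n, ℂ) × ℝ // 0 ≤ p.2 ∧ (∀ ξ, ‖p.1 ξ‖ ≤ p.2) ∧ ∀ ξ, R < ‖ξ‖ → p.1 ξ = 0}

/-- Multiplication of a test function by `|2πξ|²`. -/
noncomputable def BoundedTest.mulSymbol {R : ℝ} (χ : BoundedTest n R) : BoundedTest n R :=
  ⟨(Blackstock.mulSymbol χ.1.1, (2 * Real.pi * R) ^ 2 * χ.1.2), by
    obtain ⟨⟨χ, B⟩, hB, hχ, hs⟩ := χ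
    refine ⟨mul_nonneg (sq_nonneg _) hB, fun ξ => ?_, fun ξ hξ => ?_⟩
    · dsimp only at hB hχ hs ⊢
      rw [mulSymbol_apply, norm_mul, Complex.norm_real, Real.norm_of_nonneg (sq_nonneg _)]
      by_cases h : R < ‖ξ‖
      · rw [hs ξ h, norm_zero, mul_zero]
        positivity
      · push Not at h
        gcongr
        exact hχ ξ
    · dsimp only at hs ⊢
      rw [mulSymbol_apply, hs ξ hξ, mul_zero]⟩

lemma BoundedTest.hasCompactSupport {R : ℝ} (χ : BoundedTest n R) :
    HasCompactSupport (χ.1.1 : Space n → ℂ) :=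
  HasCompactSupport.intro (isCompact_closedBall (0 : Space n) R) fun ξ hξ =>
    χ.2.2.2 ξ (by simpa using hξ)

lemma BoundedTest.norm_integral_le {R C : ℝ} (χ : BoundedTest n R) (g : Space n → ℂ)
    (h : Space n → ℝ) (hh : IntegrableOn h (Metric.closedBall 0 R))
    (hg : ∀ ξ, ‖ξ‖ ≤ R → ‖g ξ‖ ≤ h ξ) (hC : ∫ ξ in Metric.closedBall 0 R, h ξ ≤ C) :
    ‖∫ ξ, χ.1.1 ξ * g ξ‖ ≤ C * χ.1.2 := by
  have hB := χ.2.1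
  have e : ∫ ξ, χ.1.1 ξ * g ξ = ∫ ξ in Metric.closedBall 0 R, χ.1.1 ξ * g ξ := by
    rw [setIntegral_eq_integral_of_forall_compl_eq_zero]
    intro ξ hξ
    rw [χ.2.2.2 ξ (by simpa using hξ), zero_mul]
  rw [e]
  calc _ ≤ ∫ ξ in Metric.closedBall 0 R, χ.1.2 * h ξ := by
        refine norm_integral_le_of_norm_le (hh.const_mul _) ?_
        refine (ae_restrict_mem Metric.isClosed_closedBall.measurableSet).mono fun ξ hξ => ?_
        rw [norm_mul]
        gcongr
        · exact χ.2.2.1 ξ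
        · exact hg ξ (by simpa using hξ)
    _ ≤ _ := by
        rw [integral_const_mul, mul_comm]
        gcongr

lemma pairing_congr {f g : Space n → ℂ} (h : f =ᵐ[volume] g) (φ : 𝓢(Space n, ℂ)) :
    pairing f φ = pairing g φ :=
  integral_congr_ae (h.mono fun x hx => by simp only [hx])

/-- The explicit candidate satisfies the same hierarchy of tested equations as a solution, so their
difference satisfies the homogeneous one. -/
lemma hasDerivAt_integral_fourierSolution {α β κ : ℝ} {ψ₀ ψ₁ ψ₂ : Space n → ℂ}
    (h₀ : Integrable ψ₀) (h₁ : Integrable ψ₁) (h₂ : Integrable ψ₂) {χ : 𝓢(Space n, ℂ)}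
    (hχ : HasCompactSupport χ) (t : ℝ) :
    HasDerivAt (fun t => ∫ ξ, χ ξ * (fourierSolution α β κ ψ₀ ψ₁ ψ₂ t ξ).1)
      (∫ ξ, χ ξ * (fourierSolution α β κ ψ₀ ψ₁ ψ₂ t ξ).2.1) t ∧
    HasDerivAt (fun t => ∫ ξ, χ ξ * (fourierSolution α β κ ψ₀ ψ₁ ψ₂ t ξ).2.1)
      (∫ ξ, χ ξ * (fourierSolution α β κ ψ₀ ψ₁ ψ₂ t ξ).2.2) t ∧
    HasDerivAt (fun t => ∫ ξ, χ ξ * (fourierSolution α β κ ψ₀ ψ₁ ψ₂ t ξ).2.2)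
      (-(α * (∫ ξ, mulSymbol χ ξ * (fourierSolution α β κ ψ₀ ψ₁ ψ₂ t ξ).2.2)
        + (∫ ξ, mulSymbol χ ξ * (fourierSolution α β κ ψ₀ ψ₁ ψ₂ t ξ).2.1)
        + β * (∫ ξ, mulSymbol (mulSymbol χ) ξ * (fourierSolution α β κ ψ₀ ψ₁ ψ₂ t ξ).2.1)
        + κ * (∫ ξ, mulSymbol (mulSymbol χ) ξ * (fourierSolution α β κ ψ₀ ψ₁ ψ₂ t ξ).1))) t := by
  have hc := continuous_fourierSolution α β κ h₀ h₁ h₂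
  have d0 : ∀ t ξ, HasDerivAt (fun t => (fourierSolution α β κ ψ₀ ψ₁ ψ₂ t ξ).1)
      (fourierSolution α β κ ψ₀ ψ₁ ψ₂ t ξ).2.1 t := fun t ξ => by
    simp only [fourierSolution]; exact hasDerivAt_flow_zero α β κ _ t _
  have d1 : ∀ t ξ, HasDerivAt (fun t => (fourierSolution α β κ ψ₀ ψ₁ ψ₂ t ξ).2.1)
      (fourierSolution α β κ ψ₀ ψ₁ ψ₂ t ξ).2.2 t := fun t ξ => by
    simp only [fourierSolution]; exact hasDerivAt_flow_one α β κ _ t _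
  have d2 : ∀ t ξ, HasDerivAt (fun t => (fourierSolution α β κ ψ₀ ψ₁ ψ₂ t ξ).2.2)
      (-((α * (2 * Real.pi * ‖ξ‖) ^ 2) • (fourierSolution α β κ ψ₀ ψ₁ ψ₂ t ξ).2.2
        + ((2 * Real.pi * ‖ξ‖) ^ 2 + β * ((2 * Real.pi * ‖ξ‖) ^ 2) ^ 2) •
          (fourierSolution α β κ ψ₀ ψ₁ ψ₂ t ξ).2.1
        + (κ * ((2 * Real.pi * ‖ξ‖) ^ 2) ^ 2) •
          (fourierSolution α β κ ψ₀ ψ₁ ψ₂ t ξ).1)) t := fun t ξ => by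
    simp only [fourierSolution]; exact hasDerivAt_flow_two α β κ _ t _
  have hct : Continuous fun ξ => fourierSolution α β κ ψ₀ ψ₁ ψ₂ t ξ :=
    hc.comp (f := fun ξ : Space n => (t, ξ)) (by fun_prop)
  have hm1 : HasCompactSupport (mulSymbol χ) := by
    refine hχ.mono fun ξ hξ => ?_
    rw [Function.mem_support, mulSymbol_apply] at hξ
    exact right_ne_zero_of_mul hξ
  have hm2 : HasCompactSupport (mulSymbol (mulSymbol χ)) := by
    refine hm1.mono fun ξ hξ => ?_
    rw [Function.mem_support, mulSymbol_apply] at hξ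
    exact right_ne_zero_of_mul hξ
  have hint : ∀ {χ : 𝓢(Space n, ℂ)}, HasCompactSupport χ → ∀ {g : Space n → ℂ}, Continuous g →
      Integrable fun ξ => χ ξ * g ξ := by
    intro χ hχ g hg
    exact (χ.continuous.mul hg).integrable_of_hasCompactSupport hχ.mul_right
  refine ⟨hasDerivAt_integral_mul hc.fst hc.snd.fst d0 χ.continuous hχ t,
    hasDerivAt_integral_mul hc.snd.fst hc.snd.snd d1 χ.continuous hχ t,
    (hasDerivAt_integral_mul hc.snd.snd ?_ d2 χ.continuous hχ t).congr_deriv ?_⟩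
  · have c0 := hc.fst
    have c1 := hc.snd.fst
    have c2 := hc.snd.snd
    fun_prop
  · rw [← integral_const_mul, ← integral_const_mul, ← integral_const_mul, ← integral_add,
      ← integral_add, ← integral_add, ← integral_neg]
    · congr 1
      ext ξ
      simp only [mulSymbol_apply, Complex.real_smul]
      push_cast
      ring
    · exact (((hint hm1 hct.snd.snd).const_mul _).add (hint hm1 hct.snd.fst)).add
        ((hint hm2 hct.snd.fst).const_mul _)
    · exact (hint hm2 hct.fst).const_mul _
    · exact ((hint hm1 hct.snd.snd).const_mul _).add (hint hm1 hct.snd.fst)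
    · exact (hint hm2 hct.snd.fst).const_mul _
    · exact (hint hm1 hct.snd.snd).const_mul _
    · exact hint hm1 hct.snd.fst

/-- The Fourier transform of a solution is given by the flow of the mode equation. -/
theorem IsSolution.fourierInv_ae_eq {κ γ b ν : ℝ} (hκ : 0 ≤ κ) (hα : 0 ≤ delta κ γ b ν + κ)
    (hβ : 0 ≤ κ * delta κ γ b ν + κ * (γ - 1) * (b * ν - κ)) {ψ₀ ψ₁ ψ₂ : Space n → ℂ}
    (h₀ : Integrable ψ₀) (h₁ : Integrable ψ₁) (h₂ : Integrable ψ₂)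
    {ψ : ℝ → L2 n} (h : IsSolution κ γ b ν ψ₀ ψ₁ ψ₂ ψ) {t : ℝ} (ht : 0 ≤ t) :
    ((𝓕⁻ (ψ t) : L2 n) : Space n → ℂ) =ᵐ[volume] fun ξ =>
      (fourierSolution (delta κ γ b ν + κ) (κ * delta κ γ b ν + κ * (γ - 1) * (b * ν - κ)) κ
        ψ₀ ψ₁ ψ₂ t ξ).1 := by
  obtain ⟨α, hαd⟩ : ∃ α, α = delta κ γ b ν + κ := ⟨_, rfl⟩
  obtain ⟨β, hβd⟩ : ∃ β, β = κ * delta κ γ b ν + κ * (γ - 1) * (b * ν - κ) := ⟨_, rfl⟩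
  have heq := h.equation
  rw [← hαd, ← hβd] at heq ⊢
  rw [← hαd] at hα
  rw [← hβd] at hβ
  have hc := continuous_fourierSolution α β κ h₀ h₁ h₂
  have key : ∀ R : ℝ, ∀ χ : BoundedTest n R,
      pairing (𝓕⁻ (ψ t) : L2 n) χ.1.1 =
        ∫ ξ, χ.1.1 ξ * (fourierSolution α β κ ψ₀ ψ₁ ψ₂ t ξ).1 := by
    intro R χ
    obtain ⟨M₁, hM₁⟩ := isCompact_Icc (a := (0 : ℝ)) (b := t) |>.exists_bound_of_continuousOn
      (h.continuousOn.mono Icc_subset_Ici_self)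
    obtain ⟨M₂, hM₂⟩ := (isCompact_Icc (a := (0 : ℝ)) (b := t)).prod
      (isCompact_closedBall (0 : Space n) R) |>.exists_bound_of_continuousOn hc.fst.continuousOn
    -- Both constants must hold for all tests on the ball. `N₁` comes from `x ≤ 1 + x²`, Plancherel
    -- and the bound for `ψ` on `[0, t]`; `N₂` from continuity of the candidate on a compact set.
    obtain ⟨N₁, hN₁⟩ : ∃ N, N = volume.real (Metric.closedBall (0 : Space n) R) + M₁ ^ 2 := ⟨_, rfl⟩
    obtain ⟨N₂, hN₂⟩ : ∃ N, N = volume.real (Metric.closedBall (0 : Space n) R) * |M₂| := ⟨_, rfl⟩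
    have hfin : volume (Metric.closedBall (0 : Space n) R) ≠ ⊤ :=
      (isCompact_closedBall (0 : Space n) R).measure_lt_top.ne
    have hb₁ : ∀ χ : BoundedTest n R, ∀ s, 0 ≤ s → s ≤ t →
        ‖pairing (ψ s) (𝓕⁻ χ.1.1)‖ ≤ N₁ * χ.1.2 := by
      intro χ s hs hst
      rw [pairing_fourierInv]
      have hi : IntegrableOn (fun ξ => ‖(𝓕⁻ (ψ s) : L2 n) ξ‖ ^ 2) (Metric.closedBall 0 R) :=
        (integrable_norm_sq _).integrableOn
      have h1 : IntegrableOn (fun _ : Space n => (1 : ℝ)) (Metric.closedBall 0 R) :=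
        integrableOn_const hfin
      refine χ.norm_integral_le _ (fun ξ => 1 + ‖(𝓕⁻ (ψ s) : L2 n) ξ‖ ^ 2)
        (h1.add hi) (fun ξ _ => ?_) ?_
      · nlinarith [sq_nonneg (‖(𝓕⁻ (ψ s) : L2 n) ξ‖ - 1 / 2)]
      · rw [integral_add h1 hi, hN₁]
        gcongr
        · simp
        · refine (setIntegral_le_integral (integrable_norm_sq _)
            (Eventually.of_forall fun _ => sq_nonneg _)).trans ?_
          rw [integral_norm_sq_eq, norm_fourierInv_L2]
          gcongr
          exact hM₁ s ⟨hs, hst⟩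
    have hb₂ : ∀ χ : BoundedTest n R, ∀ s, 0 ≤ s → s ≤ t →
        ‖∫ ξ, χ.1.1 ξ * (fourierSolution α β κ ψ₀ ψ₁ ψ₂ s ξ).1‖ ≤ N₂ * χ.1.2 := by
      intro χ s hs hst
      refine χ.norm_integral_le _ (fun _ => |M₂|) (integrableOn_const hfin) (fun ξ hξ => ?_) ?_
      · exact (hM₂ (s, ξ) ⟨⟨hs, hst⟩, by simpa using hξ⟩).trans (le_abs_self _)
      · simp [hN₂]
    have hm : ∀ (k : ℕ) (χ : 𝓢(Space n, ℂ)) (s : ℝ),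
        timeDeriv k ψ (Δ (𝓕⁻ χ)) s = -timeDeriv k ψ (𝓕⁻ (mulSymbol χ)) s := fun k χ s => by
      rw [laplacian_fourierInv, timeDeriv_neg]
    have hmm : ∀ (k : ℕ) (χ : 𝓢(Space n, ℂ)) (s : ℝ),
        timeDeriv k ψ (Δ (Δ (𝓕⁻ χ))) s = timeDeriv k ψ (𝓕⁻ (mulSymbol (mulSymbol χ))) s :=
      fun k χ s => by
      have : 𝓕⁻ (-mulSymbol χ) = -𝓕⁻ (mulSymbol χ) := FourierTransform.fourierInv_neg _
      rw [laplacian_fourierInv, ← this, hm, map_neg, FourierTransform.fourierInv_neg,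
        timeDeriv_neg, neg_neg]
    have hz : ∀ φ, timeDeriv 0 ψ φ = timePairing ψ φ := fun φ => iteratedDerivWithin_zero
    -- Applied to solution minus candidate, tested on functions supported in the ball of radius `R`,
    -- where the symbol is at most `(2πR)²`.
    have := eq_zero_of_mode_hierarchy (X := BoundedTest n R) (T := t) (N := N₁ + N₂)
      (ρ := (2 * Real.pi * R) ^ 2)
      BoundedTest.mulSymbol (fun χ => χ.1.2) hα hβ hκ (sq_nonneg _) (by rw [hN₁, hN₂]; positivity)
      (fun χ => χ.2.1) (fun χ => le_rfl)
      (fun χ s => timeDeriv 0 ψ (𝓕⁻ χ.1.1) s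
        - ∫ ξ, χ.1.1 ξ * (fourierSolution α β κ ψ₀ ψ₁ ψ₂ s ξ).1)
      (fun χ s => timeDeriv 1 ψ (𝓕⁻ χ.1.1) s
        - ∫ ξ, χ.1.1 ξ * (fourierSolution α β κ ψ₀ ψ₁ ψ₂ s ξ).2.1)
      (fun χ s => timeDeriv 2 ψ (𝓕⁻ χ.1.1) s
        - ∫ ξ, χ.1.1 ξ * (fourierSolution α β κ ψ₀ ψ₁ ψ₂ s ξ).2.2) ?_ ?_ ?_ ?_ ?_ ?_ ?_ χ ht le_rfl
    · rw [hz, sub_eq_zero, timePairing, pairing_fourierInv] at this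
      exact this
    · exact fun χ s hs => (hasDerivWithinAt_timeDeriv (h.contDiffOn _) (by norm_num) hs).sub
        (hasDerivAt_integral_fourierSolution h₀ h₁ h₂ χ.hasCompactSupport s).1.hasDerivWithinAt
    · exact fun χ s hs => (hasDerivWithinAt_timeDeriv (h.contDiffOn _) (by norm_num) hs).sub
        (hasDerivAt_integral_fourierSolution h₀ h₁ h₂ χ.hasCompactSupport s).2.1.hasDerivWithinAt
    · intro χ s hs
      refine ((hasDerivWithinAt_timeDeriv (h.contDiffOn _) (by norm_num) hs).sub
        (hasDerivAt_integral_fourierSolution (α := α) (β := β) (κ := κ) h₀ h₁ h₂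
          χ.hasCompactSupport s).2.2.hasDerivWithinAt).congr_deriv ?_
      have he := heq (𝓕⁻ χ.1.1) s hs
      rw [← hz, hm, hm, hmm, hmm] at he
      simp only [BoundedTest.mulSymbol]
      linear_combination he
    · intro χ
      simp only [fourierSolution, flow_zero, hz, timePairing]
      rw [pairing_congr h.initial_zero, pairing_fourierInv_of_integrable h₀, sub_self]
    · intro χ
      simp only [fourierSolution, flow_zero]
      rw [h.initial_one, pairing_fourierInv_of_integrable h₁, sub_self]
    · intro χ
      simp only [fourierSolution, flow_zero]
      rw [h.initial_two, pairing_fourierInv_of_integrable h₂, sub_self]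
    · intro χ s hs hst
      rw [hz, add_mul]
      exact (norm_sub_le _ _).trans (add_le_add (hb₁ χ s hs hst) (hb₂ χ s hs hst))
  refine ae_eq_of_pairing_eq _ (hc.comp (f := fun ξ : Space n => (t, ξ)) (by fun_prop)).fst
    fun χ hχ => ?_
  obtain ⟨R, hR⟩ := hχ.isCompact.isBounded.subset_closedBall (0 : Space n)
  obtain ⟨B, hB⟩ := hχ.exists_bound_of_continuous χ.continuous
  refine key R ⟨(χ, B), (norm_nonneg _).trans (hB 0), hB, fun ξ hξ => ?_⟩
  by_contra hne
  have := hR (subset_tsupport χ hne)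
  simp only [Metric.mem_closedBall, dist_zero_right] at this
  linarith

/-! ### Polar coordinates, the oscillation estimate and the squared rates. -/

lemma exists_radial_constant {n : ℕ} (hn : 1 ≤ n) :
    ∃ σ : ℝ, 0 < σ ∧ ∀ g : ℝ → ℝ,
      (∫ ξ : Space n, g (2 * Real.pi * ‖ξ‖) = σ * ∫ r in Ioi (0 : ℝ), r ^ (n - 1) * g r) ∧
      (IntegrableOn (fun r => r ^ (n - 1) * g r) (Ioi 0) →
        Integrable fun ξ : Space n => g (2 * Real.pi * ‖ξ‖)) := by
  have : Nonempty (Fin n) := ⟨⟨0, hn⟩⟩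
  have : Nontrivial (Space n) := inferInstance
  have h2π : 0 < 2 * Real.pi := by positivity
  have hV : 0 < volume.real (Metric.ball (0 : Space n) 1) :=
    ENNReal.toReal_pos (Metric.measure_ball_pos volume _ one_pos).ne' measure_ball_lt_top.ne
  have he : ∀ (g : ℝ → ℝ) (r : ℝ), r ^ (n - 1) • g (2 * Real.pi * r) =
      ((2 * Real.pi) ^ (n - 1))⁻¹ * ((2 * Real.pi * r) ^ (n - 1) * g (2 * Real.pi * r)) := by
    intro g r
    rw [mul_pow (2 * Real.pi) r, smul_eq_mul]
    field_simp
  refine ⟨n * (volume.real (Metric.ball (0 : Space n) 1) *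
    (((2 * Real.pi) ^ (n - 1))⁻¹ * (2 * Real.pi)⁻¹)), by positivity, fun g => ⟨?_, fun hg => ?_⟩⟩
  · rw [integral_fun_norm_addHaar (volume : Measure (Space n)) fun x => g (2 * Real.pi * x)]
    simp only [finrank_euclideanSpace, Fintype.card_fin]
    simp only [he]
    rw [integral_const_mul, integral_comp_mul_left_Ioi (fun r => r ^ (n - 1) * g r) 0 h2π]
    simp only [mul_zero, smul_eq_mul, nsmul_eq_mul]
    ring
  · rw [integrable_fun_norm_addHaar (volume : Measure (Space n)) (f := fun x => g (2 * Real.pi * x))]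
    simp only [finrank_euclideanSpace, Fintype.card_fin]
    simp only [he]
    refine Integrable.const_mul ?_ _
    have := (integrableOn_Ioi_comp_mul_left_iff (fun r => r ^ (n - 1) * g r) 0 h2π).2
      (by simpa using hg)
    exact this

/-- Translation by `π` flips the sign of `cos`, so `s` or `s + π` lies in the set. As `s ≥ π`, also
`1/s ≤ 2/(s + π)`. Hence `1/s ≤ f(s) + 2f(s + π)`, where `f` is `1/s` cut off to the set, and
integration gives the factor `1 + 2 = 3`. -/
lemma log_div_le_integral_inv_cos_nonpos {X Y : ℝ} (hY : Real.pi ≤ Y) (hX : Y + Real.pi ≤ X) :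
    Real.log ((X - Real.pi) / Y) ≤
      3 * ∫ s in {s | Real.cos s ≤ 0} ∩ Ioc Y X, s⁻¹ := by
  have hπ := Real.pi_pos
  have hY0 : 0 < Y := by linarith
  have hA : MeasurableSet {s | Real.cos s ≤ 0} := measurableSet_le Real.measurable_cos measurable_const
  obtain ⟨f, hf⟩ : ∃ f : ℝ → ℝ, f = {s | Real.cos s ≤ 0}.indicator fun s => s⁻¹ := ⟨_, rfl⟩
  have hf0 : ∀ s, 0 ≤ s → 0 ≤ f s := fun s hs => by
    rw [hf]; exact indicator_apply_nonneg fun _ => inv_nonneg.2 hs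
  have hinv : IntegrableOn (fun s : ℝ => s⁻¹) (Ioc Y X) :=
    ((continuousOn_inv₀.mono fun s hs => (hY0.trans_le hs.1).ne').integrableOn_Icc
      (a := Y) (b := X)).mono_set Ioc_subset_Icc_self
  have hfi : IntegrableOn f (Ioc Y X) := by rw [hf]; exact hinv.indicator hA
  have hi : ∀ a b, Y ≤ a → a ≤ b → b ≤ X → IntervalIntegrable f volume a b := fun a b ha hab hb =>
    (intervalIntegrable_iff_integrableOn_Ioc_of_le hab).2 (hfi.mono_set (Ioc_subset_Ioc ha hb))
  have hmono : ∀ a b, Y ≤ a → a ≤ b → b ≤ X → ∫ s in a..b, f s ≤ ∫ s in Y..X, f s := by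
    intro a b ha hab hb
    rw [intervalIntegral.integral_of_le hab, intervalIntegral.integral_of_le (by linarith)]
    apply setIntegral_mono_set hfi _ (Ioc_subset_Ioc ha hb).eventuallyLE
    exact (ae_restrict_mem measurableSet_Ioc).mono fun s hs => hf0 s (hY0.trans hs.1).le
  have hval : ∫ s in Y..X, f s = ∫ s in {s | Real.cos s ≤ 0} ∩ Ioc Y X, s⁻¹ := by
    rw [intervalIntegral.integral_of_le (by linarith), hf, integral_indicator hA,
      Measure.restrict_restrict hA]
  rw [← hval, ← integral_inv_of_pos hY0 (by linarith)]
  have hshift : IntervalIntegrable (fun s => f (s + Real.pi)) volume Y (X - Real.pi) := by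
    have := (hi (Y + Real.pi) X (by linarith) hX le_rfl).comp_add_right Real.pi
    simpa using this
  have h1 : ∫ s in Y..(X - Real.pi), s⁻¹ ≤
      ∫ s in Y..(X - Real.pi), (f s + 2 * f (s + Real.pi)) := by
    apply intervalIntegral.integral_mono_on (by linarith)
    · exact (intervalIntegrable_iff_integrableOn_Ioc_of_le (by linarith)).2
        (hinv.mono_set (Ioc_subset_Ioc le_rfl (by linarith)))
    · exact (hi Y _ le_rfl (by linarith) (by linarith)).add (hshift.const_mul 2)
    · intro s hs
      have hs0 : 0 < s := hY0.trans_le hs.1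
      by_cases hc : Real.cos s ≤ 0
      · have : f s = s⁻¹ := by rw [hf]; exact indicator_of_mem (s := {s | Real.cos s ≤ 0}) hc _
        have := hf0 (s + Real.pi) (by linarith)
        linarith
      · have : f (s + Real.pi) = (s + Real.pi)⁻¹ := by
          rw [hf]
          apply indicator_of_mem (s := {s | Real.cos s ≤ 0})
          rw [mem_ofPred_eq, Real.cos_add_pi]
          linarith
        have h2 : s⁻¹ ≤ 2 * (s + Real.pi)⁻¹ := by
          rw [← div_eq_mul_inv, inv_eq_one_div, div_le_div_iff₀ hs0 (by linarith)]
          linarith [hs.1]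
        have := hf0 s hs0.le
        linarith
  rw [intervalIntegral.integral_add (hi Y _ le_rfl (by linarith) (by linarith))
    (hshift.const_mul 2), intervalIntegral.integral_const_mul,
    intervalIntegral.integral_comp_add_right (fun s => f s) Real.pi, sub_add_cancel] at h1
  have m1 := hmono Y (X - Real.pi) le_rfl (by linarith) (by linarith)
  have m2 := hmono (Y + Real.pi) X (by linarith) hX le_rfl
  linarith

lemma rate_three_sq {t : ℝ} (ht : 0 ≤ t) : rate 3 t ^ 2 = t := by
  rw [rate, if_pos le_rfl, ← Real.rpow_natCast, ← Real.rpow_mul ht]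
  norm_num

lemma rate_four_sq {t : ℝ} (ht : 1 ≤ t) : rate 4 t ^ 2 = Real.log t := by
  rw [rate, if_neg (by norm_num), if_pos rfl, ← Real.rpow_natCast,
    ← Real.rpow_mul (Real.log_nonneg ht)]
  norm_num

lemma rate_of_five_le {n : ℕ} (hn : 5 ≤ n) (t : ℝ) : rate n t = t ^ (1 - (n : ℝ) / 4) := by
  rw [rate, if_neg (by omega), if_neg (by omega)]

lemma rate_sq_of_five_le {n : ℕ} (hn : 5 ≤ n) {t : ℝ} (ht : 0 ≤ t) :
    rate n t ^ 2 = t ^ (-((n : ℝ) - 4) / 2) := by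
  rw [rate_of_five_le hn, ← Real.rpow_natCast, ← Real.rpow_mul ht]
  congr 1
  push_cast
  ring

lemma rate_nonneg (n : ℕ) {t : ℝ} (ht : 1 ≤ t) : 0 ≤ rate n t := by
  have := Real.log_nonneg ht
  unfold rate
  split_ifs <;> positivity

lemma pow_div_pow_four {n : ℕ} (hn : 1 ≤ n) {r : ℝ} (hr : 0 < r) :
    r ^ (n - 1) * (r ^ 4)⁻¹ = r ^ ((n : ℝ) - 5) := by
  rw [← Real.rpow_natCast, ← Real.rpow_natCast, ← Real.rpow_neg hr.le, ← Real.rpow_add hr,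
    Nat.cast_sub hn]
  congr 1
  push_cast
  ring

/-! ### Low-frequency majorants for the upper bound. -/

/-- A majorant, of integral `O(rate n t ^ 2)`, of the low frequency part of the squared
fundamental solution, in polar coordinates. -/
def HasLowFrequencyMajorant (n : ℕ) (c C t : ℝ) : Prop :=
  ∃ G : ℝ → ℝ, (∀ r, 0 < r → 0 ≤ G r) ∧ IntegrableOn G (Ioi 0) ∧
    ∫ r in Ioi 0, G r ≤ C * rate n t ^ 2 ∧
    ∀ r, 0 < r → r ≤ 1 → (r ≤ t⁻¹ → r ^ (n - 1) * t ^ 4 ≤ G r) ∧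
      (t⁻¹ < r → r ^ (n - 1) * ((r ^ 4)⁻¹ * Real.exp (-(c * r ^ 2 * t))) ≤ G r)

/-- The majorant is `t²` up to `1/t` and `r⁻²` beyond; each piece has integral `t`. -/
lemma hasLowFrequencyMajorant_three {c t : ℝ} (hc : 0 < c) (ht : 3 ≤ t) :
    HasLowFrequencyMajorant 3 c 2 t := by
  have ht0 : 0 < t := by linarith
  have hti : 0 < t⁻¹ := by positivity
  have i1 : IntegrableOn (fun _ : ℝ => t ^ 2) (Ioc 0 t⁻¹) := integrableOn_const (by simp)
  have i2 : IntegrableOn (fun r : ℝ => r ^ (-2 : ℝ)) (Ioi t⁻¹) :=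
    integrableOn_Ioi_rpow_of_lt (by norm_num) hti
  have j1 : Integrable ((Ioc 0 t⁻¹).indicator fun _ : ℝ => t ^ 2) :=
    i1.integrable_indicator measurableSet_Ioc
  have j2 : Integrable ((Ioi t⁻¹).indicator fun r : ℝ => r ^ (-2 : ℝ)) :=
    i2.integrable_indicator measurableSet_Ioi
  refine ⟨fun r => (Ioc 0 t⁻¹).indicator (fun _ => t ^ 2) r
    + (Ioi t⁻¹).indicator (fun r => r ^ (-2 : ℝ)) r, fun r hr => ?_,
    (j1.add j2).integrableOn, ?_, fun r hr hr1 => ⟨fun h => ?_, fun h => ?_⟩⟩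
  · apply add_nonneg <;> apply indicator_apply_nonneg <;> intro _ <;> positivity
  · rw [integral_add j1.integrableOn j2.integrableOn, setIntegral_indicator measurableSet_Ioc,
      setIntegral_indicator measurableSet_Ioi, inter_eq_right.2 Ioc_subset_Ioi_self,
      inter_eq_right.2 (Ioi_subset_Ioi hti.le), integral_Ioi_rpow_of_lt (by norm_num) hti,
      setIntegral_const, rate_three_sq ht0.le]
    have e : t⁻¹ ^ (-2 + 1 : ℝ) = t := by
      norm_num [Real.rpow_neg_one]
    rw [e]
    simp [hti.le]
    field_simp
    linarith
  · beta_reduce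
    rw [indicator_of_mem (show r ∈ Ioc 0 t⁻¹ from ⟨hr, h⟩), indicator_of_notMem (by simpa using h)]
    have : r ^ 2 ≤ t⁻¹ ^ 2 := by gcongr
    calc r ^ (3 - 1) * t ^ 4 ≤ t⁻¹ ^ 2 * t ^ 4 := by gcongr
      _ = t ^ 2 + 0 := by field_simp; ring
  · beta_reduce
    rw [indicator_of_mem (show r ∈ Ioi t⁻¹ from h), indicator_of_notMem (by simp [h]), zero_add]
    rw [← mul_assoc, pow_div_pow_four (by norm_num) hr]
    norm_num
    apply mul_le_of_le_one_right (by positivity)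
    rw [Real.exp_le_one_iff]
    have : 0 ≤ c * r ^ 2 * t := by positivity
    linarith

/-- The majorant is `t` up to `1/t`, with integral `1`, and `1/r` up to `1`, with integral `log t`.
Since `t ≥ 3 > e`, the former is at most the latter. -/
lemma hasLowFrequencyMajorant_four {c t : ℝ} (hc : 0 < c) (ht : 3 ≤ t) :
    HasLowFrequencyMajorant 4 c 2 t := by
  have ht0 : 0 < t := by linarith
  have hti : 0 < t⁻¹ := by positivity
  have hti1 : t⁻¹ ≤ 1 := inv_le_one_of_one_le₀ (by linarith)
  have i1 : IntegrableOn (fun _ : ℝ => t) (Ioc 0 t⁻¹) := integrableOn_const (by simp)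
  have hsub : Ioc t⁻¹ 1 ⊆ Ioi 0 := fun r hr => hti.trans hr.1
  have i2 : IntegrableOn (fun r : ℝ => r⁻¹) (Ioc t⁻¹ 1) :=
    ((continuousOn_inv₀.mono fun s hs => (hti.trans_le hs.1).ne').integrableOn_Icc
      (a := t⁻¹) (b := 1)).mono_set Ioc_subset_Icc_self
  have j1 : Integrable ((Ioc 0 t⁻¹).indicator fun _ : ℝ => t) :=
    i1.integrable_indicator measurableSet_Ioc
  have j2 : Integrable ((Ioc t⁻¹ 1).indicator fun r : ℝ => r⁻¹) :=
    i2.integrable_indicator measurableSet_Ioc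
  refine ⟨fun r => (Ioc 0 t⁻¹).indicator (fun _ => t) r
    + (Ioc t⁻¹ 1).indicator (fun r => r⁻¹) r, fun r hr => ?_,
    (j1.add j2).integrableOn, ?_, fun r hr hr1 => ⟨fun h => ?_, fun h => ?_⟩⟩
  · apply add_nonneg <;> apply indicator_apply_nonneg <;> intro _ <;> positivity
  · rw [integral_add j1.integrableOn j2.integrableOn, setIntegral_indicator measurableSet_Ioc,
      setIntegral_indicator measurableSet_Ioc, inter_eq_right.2 Ioc_subset_Ioi_self,
      inter_eq_right.2 hsub, ← intervalIntegral.integral_of_le hti1,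
      integral_inv_of_pos hti one_pos, setIntegral_const, rate_four_sq (by linarith)]
    have hlog : 1 ≤ Real.log t := by
      rw [Real.le_log_iff_exp_le ht0]
      linarith [Real.exp_one_lt_d9]
    simp [hti.le]
    field_simp
    linarith
  · beta_reduce
    rw [indicator_of_mem (show r ∈ Ioc 0 t⁻¹ from ⟨hr, h⟩),
      indicator_of_notMem (fun h' => by linarith [h'.1])]
    have : r ^ 3 ≤ t⁻¹ ^ 3 := by gcongr
    calc r ^ (4 - 1) * t ^ 4 ≤ t⁻¹ ^ 3 * t ^ 4 := by gcongr
      _ = t + 0 := by field_simp; ring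
  · beta_reduce
    rw [indicator_of_mem (show r ∈ Ioc t⁻¹ 1 from ⟨h, hr1⟩), indicator_of_notMem (by simp [h]),
      zero_add, ← mul_assoc, pow_div_pow_four (by norm_num) hr]
    norm_num [Real.rpow_neg_one]
    apply mul_le_of_le_one_right (by positivity)
    rw [Real.exp_le_one_iff]
    have : 0 ≤ c * r ^ 2 * t := by positivity
    linarith

/-- Now `r^(n-5)` is integrable at `0`, so one Gaussian serves both ranges. The factor `exp c`
compensates its decay on `r ≤ 1/t`, where `r² t ≤ 1`. -/
lemma hasLowFrequencyMajorant_of_five_le {n : ℕ} (hn : 5 ≤ n) {c : ℝ} (hc : 0 < c) :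
    ∃ C, 0 < C ∧ ∀ t, 3 ≤ t → HasLowFrequencyMajorant n c C t := by
  have hn5 : (5 : ℝ) ≤ n := by exact_mod_cast hn
  have hΓ : 0 < Real.Gamma (((n : ℝ) - 4) / 2) := Real.Gamma_pos_of_pos (by linarith)
  refine ⟨Real.exp c * (c ^ (-((n : ℝ) - 4) / 2) * (1 / 2) * Real.Gamma (((n : ℝ) - 4) / 2)),
    by positivity, fun t ht => ?_⟩
  have ht0 : 0 < t := by linarith
  have hti : 0 < t⁻¹ := by positivity
  have hle : ∀ r, 0 < r → r ^ (n - 1) * ((r ^ 4)⁻¹ * Real.exp (-(c * r ^ 2 * t))) =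
      r ^ ((n : ℝ) - 5) * Real.exp (-(c * t) * r ^ (2 : ℝ)) := fun r hr => by
    rw [← mul_assoc, pow_div_pow_four (by omega) hr, Real.rpow_two]
    congr 2
    ring
  refine ⟨fun r => Real.exp c * (r ^ ((n : ℝ) - 5) * Real.exp (-(c * t) * r ^ (2 : ℝ))),
    fun r hr => by positivity,
    (integrableOn_rpow_mul_exp_neg_mul_rpow (by linarith) two_pos (by positivity)).const_mul _,
    ?_, fun r hr hr1 => ⟨fun h => ?_, fun h => ?_⟩⟩
  · rw [integral_const_mul, integral_rpow_mul_exp_neg_mul_rpow two_pos (by linarith) (by positivity),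
      rate_sq_of_five_le hn ht0.le]
    have e : (n : ℝ) - 5 + 1 = n - 4 := by ring
    rw [e, Real.mul_rpow hc.le ht0.le]
    apply le_of_eq
    ring
  · beta_reduce
    rw [← hle r hr]
    have h1 : t ^ 4 ≤ (r ^ 4)⁻¹ := by
      rw [le_inv_comm₀ (by positivity) (by positivity), ← inv_pow]
      gcongr
    have h2 : 1 ≤ Real.exp c * Real.exp (-(c * r ^ 2 * t)) := by
      rw [← Real.exp_add]
      apply Real.one_le_exp
      have : r ^ 2 * t ≤ 1 := by
        calc r ^ 2 * t = r * (r * t) := by ring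
          _ ≤ 1 * (t⁻¹ * t) := by gcongr
          _ = 1 := by field_simp
      nlinarith
    calc r ^ (n - 1) * t ^ 4 ≤ r ^ (n - 1) * (r ^ 4)⁻¹ * 1 := by rw [mul_one]; gcongr
      _ ≤ r ^ (n - 1) * (r ^ 4)⁻¹ * (Real.exp c * Real.exp (-(c * r ^ 2 * t))) := by gcongr
      _ = _ := by ring
  · rw [hle r hr]
    exact le_mul_of_one_le_left (by positivity) (Real.one_le_exp hc.le)

lemma exists_hasLowFrequencyMajorant {n : ℕ} (hn : 3 ≤ n) {c : ℝ} (hc : 0 < c) :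
    ∃ C, 0 < C ∧ ∀ t, 3 ≤ t → HasLowFrequencyMajorant n c C t := by
  obtain rfl | rfl | h : n = 3 ∨ n = 4 ∨ 5 ≤ n := by omega
  · exact ⟨2, two_pos, fun t => hasLowFrequencyMajorant_three hc⟩
  · exact ⟨2, two_pos, fun t => hasLowFrequencyMajorant_four hc⟩
  · exact hasLowFrequencyMajorant_of_five_le h hc

/-! ### Frequency windows for the lower bound. -/

/-- The frequencies `r` with `cos (r t) ≤ 0` and `Y < r t ≤ X`. -/
def oscillationSet (t Y X : ℝ) : Set ℝ := {r | Real.cos (r * t) ≤ 0} ∩ {r | r * t ∈ Ioc Y X}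

/-- The substitution `s = rt` extracts the power of `t`. Comparing `s^(n-5)` with `L/s` reduces
every dimension to the same logarithmic estimate. -/
lemma le_integral_oscillationSet {n : ℕ} (hn : 1 ≤ n) {t X Y L : ℝ} (ht : 0 < t) (hL0 : 0 ≤ L)
    (hY : Real.pi ≤ Y) (hX : Y + Real.pi ≤ X)
    (hL : ∀ s ∈ Ioc Y X, L * s⁻¹ ≤ s ^ (n - 1) * (s ^ 4)⁻¹) :
    t ^ (4 - (n : ℝ)) * (L * (Real.log ((X - Real.pi) / Y) / 3)) ≤
      ∫ r in Ioi 0, r ^ (n - 1) * (oscillationSet t Y X).indicator (fun r => (r ^ 4)⁻¹) r := by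
  have hπ := Real.pi_pos
  have hY0 : 0 < Y := by linarith
  obtain ⟨A, hAdef⟩ : ∃ A, A = {s | Real.cos s ≤ 0} ∩ Ioc Y X := ⟨_, rfl⟩
  have hA : MeasurableSet A := by
    rw [hAdef]
    exact (measurableSet_le Real.measurable_cos measurable_const).inter measurableSet_Ioc
  have hAsub : A ⊆ Ioc Y X := by rw [hAdef]; exact inter_subset_right
  have hA0 : A ⊆ Ioi 0 := fun s hs => hY0.trans (hAsub hs).1
  have hint : ∀ f : ℝ → ℝ, ContinuousOn f (Icc Y X) → IntegrableOn f A := fun f hf =>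
    hf.integrableOn_Icc.mono_set (hAsub.trans Ioc_subset_Icc_self)
  have hne : ∀ s ∈ Icc Y X, s ≠ 0 := fun s hs => (hY0.trans_le hs.1).ne'
  have e : ∀ r ∈ Ioi (0 : ℝ), r ^ (n - 1) * (oscillationSet t Y X).indicator (fun r => (r ^ 4)⁻¹) r =
      t ^ (5 - (n : ℝ)) * A.indicator (fun s => s ^ (n - 1) * (s ^ 4)⁻¹) (t * r) := by
    intro r hr
    have hr : 0 < r := hr
    by_cases h : r ∈ oscillationSet t Y X
    · have h' : t * r ∈ A := by rw [hAdef, mul_comm]; exact h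
      rw [indicator_of_mem h, indicator_of_mem h', pow_div_pow_four hn hr,
        pow_div_pow_four hn (by positivity), Real.mul_rpow ht.le hr.le, ← mul_assoc,
        ← Real.rpow_add ht]
      simp
    · have h' : t * r ∉ A := by rw [hAdef, mul_comm]; exact h
      rw [indicator_of_notMem h, indicator_of_notMem h', mul_zero, mul_zero]
  rw [setIntegral_congr_fun measurableSet_Ioi e, integral_const_mul,
    integral_comp_mul_left_Ioi _ 0 ht, mul_zero, setIntegral_indicator hA, inter_eq_right.2 hA0,
    smul_eq_mul]
  have ht' : t ^ (5 - (n : ℝ)) * t⁻¹ = t ^ (4 - (n : ℝ)) := by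
    rw [← Real.rpow_neg_one, ← Real.rpow_add ht]
    congr 1
    ring
  rw [← mul_assoc (t ^ (5 - (n : ℝ))), ht']
  gcongr
  have h1 := log_div_le_integral_inv_cos_nonpos hY hX
  rw [← hAdef] at h1
  calc L * (Real.log ((X - Real.pi) / Y) / 3) ≤ L * ∫ s in A, s⁻¹ := by gcongr; linarith
    _ = ∫ s in A, L * s⁻¹ := by rw [integral_const_mul]
    _ ≤ ∫ s in A, s ^ (n - 1) * (s ^ 4)⁻¹ := by
      apply setIntegral_mono_on _ _ hA (fun s hs => hL s (hAsub hs))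
      · exact (hint _ (continuousOn_inv₀.mono hne)).const_mul L
      · exact hint _ ((continuousOn_pow _).mul ((continuousOn_pow 4).inv₀ fun s hs =>
          pow_ne_zero 4 (hne s hs)))

/-- The window in `s = rt` is fixed, since the integral lives at `r ~ 1/t`. The choice `(X - π)/π =
e³` cancels the division by `3`. -/
lemma exists_oscillationSet_three {ε : ℝ} (hε : 0 < ε) :
    ∃ c : ℝ, 0 < c ∧ ∀ᶠ t in atTop, ∃ Y X : ℝ, 0 < Y ∧ X ^ 2 ≤ ε * t ∧ c * rate 3 t ^ 2 ≤
      ∫ r in Ioi 0, r ^ (3 - 1) * (oscillationSet t Y X).indicator (fun r => (r ^ 4)⁻¹) r := by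
  have hπ := Real.pi_pos
  have he : 1 ≤ Real.exp 3 := Real.one_le_exp (by norm_num)
  obtain ⟨X, hX⟩ : ∃ X, X = Real.pi * Real.exp 3 + Real.pi := ⟨_, rfl⟩
  have hX0 : 0 < X := by rw [hX]; positivity
  refine ⟨X⁻¹, by positivity, ?_⟩
  filter_upwards [eventually_gt_atTop 0, eventually_ge_atTop (X ^ 2 / ε)] with t ht ht'
  rw [div_le_iff₀ hε] at ht'
  refine ⟨Real.pi, X, hπ, by linarith, ?_⟩
  refine le_trans ?_ (le_integral_oscillationSet (n := 3) (L := X⁻¹) (by norm_num) ht (by positivity)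
    le_rfl (by rw [hX]; nlinarith) fun s hs => ?_)
  · have : (X - Real.pi) / Real.pi = Real.exp 3 := by rw [hX]; field_simp; ring
    rw [this, Real.log_exp, rate_three_sq ht.le]
    norm_num
    linarith
  · have hs0 : 0 < s := hπ.trans hs.1
    calc X⁻¹ * s⁻¹ ≤ s⁻¹ * s⁻¹ := by gcongr; exact hs.2
      _ = s ^ (3 - 1) * (s ^ 4)⁻¹ := by field_simp

/-- The window runs from `π` to `√(εt)`, and its logarithmic length is what produces `log t`. For
large `t` the ratio of endpoints exceeds `t^(1/4)`, whence `1/12 = (1/4)(1/3)`. -/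
lemma exists_oscillationSet_four {ε : ℝ} (hε : 0 < ε) :
    ∃ c : ℝ, 0 < c ∧ ∀ᶠ t in atTop, ∃ Y X : ℝ, 0 < Y ∧ X ^ 2 ≤ ε * t ∧ c * rate 4 t ^ 2 ≤
      ∫ r in Ioi 0, r ^ (4 - 1) * (oscillationSet t Y X).indicator (fun r => (r ^ 4)⁻¹) r := by
  have hπ := Real.pi_pos
  refine ⟨1 / 12, by positivity, ?_⟩
  have h1 := (tendsto_rpow_atTop (show (0 : ℝ) < 1 / 4 by norm_num)).eventually_ge_atTop
    (2 * Real.pi / Real.sqrt ε)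
  filter_upwards [eventually_ge_atTop 1, h1] with t ht ht'
  have ht0 : 0 < t := by linarith
  obtain ⟨q, hq⟩ : ∃ q, q = t ^ (1 / 4 : ℝ) := ⟨_, rfl⟩
  have hq1 : 1 ≤ q := by rw [hq]; exact Real.one_le_rpow ht (by norm_num)
  have hqt : Real.sqrt t = q * q := by
    rw [hq, ← Real.rpow_add ht0, Real.sqrt_eq_rpow]
    norm_num
  rw [← hq, div_le_iff₀ (Real.sqrt_pos.2 hε)] at ht'
  obtain ⟨X, hX⟩ : ∃ X, X = Real.sqrt (ε * t) := ⟨_, rfl⟩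
  have hXq : 2 * Real.pi * q ≤ X := by
    rw [hX, Real.sqrt_mul hε.le, hqt]
    nlinarith
  refine ⟨Real.pi, X, hπ, by rw [hX, Real.sq_sqrt (by positivity)], ?_⟩
  refine le_trans ?_ (le_integral_oscillationSet (n := 4) (L := 1) (by norm_num) ht0 zero_le_one
    le_rfl (by nlinarith) fun s hs => ?_)
  · rw [rate_four_sq ht]
    have h2 : Real.log q ≤ Real.log ((X - Real.pi) / Real.pi) := by
      apply Real.log_le_log (by linarith)
      rw [le_div_iff₀ hπ]
      nlinarith
    have h3 : Real.log q = 1 / 4 * Real.log t := by rw [hq, Real.log_rpow ht0]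
    norm_num
    linarith
  · have hs0 : 0 < s := hπ.trans hs.1
    apply le_of_eq
    field_simp

/-- Both endpoints are multiples of `√t`, the diffusive scale. Their ratio `2e³` leaves a logarithm
of at least `3`. -/
lemma exists_oscillationSet_of_five_le {n : ℕ} (hn : 5 ≤ n) {ε : ℝ} (hε : 0 < ε) :
    ∃ c : ℝ, 0 < c ∧ ∀ᶠ t in atTop, ∃ Y X : ℝ, 0 < Y ∧ X ^ 2 ≤ ε * t ∧ c * rate n t ^ 2 ≤
      ∫ r in Ioi 0, r ^ (n - 1) * (oscillationSet t Y X).indicator (fun r => (r ^ 4)⁻¹) r := by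
  have hπ := Real.pi_pos
  have he : 1 ≤ Real.exp 3 := Real.one_le_exp (by norm_num)
  have hn5 : (5 : ℝ) ≤ n := by exact_mod_cast hn
  obtain ⟨a, ha⟩ : ∃ a, a = Real.sqrt ε / (2 * Real.exp 3) := ⟨_, rfl⟩
  have ha0 : 0 < a := by rw [ha]; positivity
  refine ⟨a ^ ((n : ℝ) - 4), by positivity, ?_⟩
  have h1 := (tendsto_rpow_atTop (show (0 : ℝ) < 1 / 2 by norm_num)).eventually_ge_atTop
    (Real.pi / a)
  filter_upwards [eventually_ge_atTop 1, h1] with t ht ht'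
  have ht0 : 0 < t := by linarith
  rw [div_le_iff₀ ha0] at ht'
  obtain ⟨Y, hY⟩ : ∃ Y, Y = t ^ (1 / 2 : ℝ) * a := ⟨_, rfl⟩
  obtain ⟨X, hX⟩ : ∃ X, X = 2 * Real.exp 3 * Y := ⟨_, rfl⟩
  rw [← hY] at ht'
  have hY0 : 0 < Y := by linarith
  have hXt : X = Real.sqrt (ε * t) := by
    rw [hX, hY, ha, Real.sqrt_mul hε.le, Real.sqrt_eq_rpow t]
    field_simp
  have hXY : Real.exp 3 * Y ≤ X - Real.pi := by nlinarith
  refine ⟨Y, X, hY0, by rw [hXt, Real.sq_sqrt (by positivity)], ?_⟩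
  refine le_trans ?_ (le_integral_oscillationSet (n := n) (L := Y ^ ((n : ℝ) - 4)) (by omega) ht0
    (by positivity) ht' (by nlinarith) fun s hs => ?_)
  · have h2 : 3 ≤ Real.log ((X - Real.pi) / Y) := by
      rw [Real.le_log_iff_exp_le (div_pos (by nlinarith) hY0), le_div_iff₀ hY0]
      exact hXY
    have h3 : a ^ ((n : ℝ) - 4) * rate n t ^ 2 = t ^ (4 - (n : ℝ)) * Y ^ ((n : ℝ) - 4) := by
      rw [rate_sq_of_five_le hn ht0.le, hY, Real.mul_rpow (by positivity) ha0.le,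
        ← Real.rpow_mul ht0.le, ← mul_assoc, ← Real.rpow_add ht0, mul_comm]
      congr 2
      ring
    rw [h3]
    gcongr
    apply le_mul_of_one_le_right (by positivity)
    linarith
  · have hs0 : 0 < s := hY0.trans hs.1
    rw [pow_div_pow_four (by omega) hs0]
    calc Y ^ ((n : ℝ) - 4) * s⁻¹ ≤ s ^ ((n : ℝ) - 4) * s⁻¹ := by
          gcongr
          · linarith
          · exact hs.1.le
      _ = s ^ ((n : ℝ) - 5) := by
          rw [← Real.rpow_neg_one, ← Real.rpow_add hs0]
          congr 1
          ring

lemma exists_oscillationSet {n : ℕ} (hn : 3 ≤ n) {ε : ℝ} (hε : 0 < ε) :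
    ∃ c : ℝ, 0 < c ∧ ∀ᶠ t in atTop, ∃ Y X : ℝ, 0 < Y ∧ X ^ 2 ≤ ε * t ∧ c * rate n t ^ 2 ≤
      ∫ r in Ioi 0, r ^ (n - 1) * (oscillationSet t Y X).indicator (fun r => (r ^ 4)⁻¹) r := by
  obtain rfl | rfl | h : n = 3 ∨ n = 4 ∨ 5 ≤ n := by omega
  · exact exists_oscillationSet_three hε
  · exact exists_oscillationSet_four hε
  · exact exists_oscillationSet_of_five_le h hε

/-! ### Bounds for the flow in terms of the unscaled data. -/

lemma sum_sq_le_sq_sum {a b c : ℝ} (ha : 0 ≤ a) (hb : 0 ≤ b) (hc : 0 ≤ c) :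
    c ^ 2 + b ^ 2 + a ^ 2 ≤ (a + b + c) ^ 2 := by
  nlinarith [mul_nonneg ha hb, mul_nonneg ha hc, mul_nonneg hb hc]

-- The first two regimes come from the decay estimate with data `v₀, v₁/r, v₂/r²`; the third, where
-- `r⁻⁴` would be too singular, from the short-time bound. The halved rate reflects `r²/(1 + r²) ≥
-- 1/2` for `r ≥ 1` and `≥ r²/2` for `r ≤ 1`.
set_option maxHeartbeats 800000 in
lemma norm_flow_le {α β κ : ℝ} (hκ : 0 < κ) (hα : κ < α) (hβ : 0 < β) :
    ∃ c C : ℝ, 0 < c ∧ 0 < C ∧ ∀ t : ℝ, 1 ≤ t → ∀ r : ℝ, 0 < r → ∀ v : ℂ × ℂ × ℂ,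
      (1 ≤ r → ‖(flow α β κ (r ^ 2) t v).1‖ ^ 2 ≤
        C * Real.exp (-(c * t)) * (‖v.1‖ ^ 2 + ‖v.2.1‖ ^ 2 + ‖v.2.2‖ ^ 2)) ∧
      (r ≤ 1 → ‖(flow α β κ (r ^ 2) t v).1‖ ^ 2 ≤
        C * ((r ^ 4)⁻¹ * Real.exp (-(c * r ^ 2 * t))) * (‖v.1‖ + ‖v.2.1‖ + ‖v.2.2‖) ^ 2) ∧
      (r ≤ 1 → r ≤ t⁻¹ → ‖(flow α β κ (r ^ 2) t v).1‖ ^ 2 ≤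
        C * t ^ 4 * (‖v.1‖ + ‖v.2.1‖ + ‖v.2.2‖) ^ 2) := by
  obtain ⟨c, C, hc, hC, H⟩ := IsMode.decay hκ hα hβ
  obtain ⟨K, hK, HK⟩ := IsMode.short_time hκ hα hβ
  refine ⟨c / 2, C + (1 + K) ^ 2, by positivity, by positivity, fun t ht r hr v => ?_⟩
  have ht0 : 0 ≤ t := by linarith
  have hCC : C ≤ C + (1 + K) ^ 2 := by linarith [sq_nonneg (1 + K)]
  have hd := H r hr _ _ _ (isMode_flow α β κ hr v) t ht0
  simp only [flow_zero, norm_smul, norm_inv, Real.norm_of_nonneg hr.le,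
    Real.norm_of_nonneg (sq_nonneg r), mul_pow] at hd
  obtain ⟨y, hy⟩ : ∃ y, y = ‖(flow α β κ (r ^ 2) t v).1‖ := ⟨_, rfl⟩
  obtain ⟨E, hE⟩ : ∃ E, E = Real.exp (-(c * (r ^ 2 / (1 + r ^ 2)) * t)) := ⟨_, rfl⟩
  have hE0 : 0 < E := by rw [hE]; positivity
  obtain ⟨a₀, ha₀⟩ : ∃ a, a = ‖v.1‖ := ⟨_, rfl⟩
  obtain ⟨a₁, ha₁⟩ : ∃ a, a = ‖v.2.1‖ := ⟨_, rfl⟩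
  obtain ⟨a₂, ha₂⟩ : ∃ a, a = ‖v.2.2‖ := ⟨_, rfl⟩
  have p₀ : 0 ≤ a₀ := ha₀ ▸ norm_nonneg _
  have p₁ : 0 ≤ a₁ := ha₁ ▸ norm_nonneg _
  have p₂ : 0 ≤ a₂ := ha₂ ▸ norm_nonneg _
  rw [← hE, ← hy, ← ha₀, ← ha₁, ← ha₂] at hd
  have hr2 : 0 < r ^ 2 := by positivity
  have hy2 : y ^ 2 ≤ C * E * (a₂ ^ 2 / r ^ 4 + a₁ ^ 2 / r ^ 2 + a₀ ^ 2) := by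
    have h1 : (1 + r ^ 2) * y ^ 2 ≤
        C * E * ((1 + r ^ 2) * (a₂ ^ 2 / r ^ 4 + a₁ ^ 2 / r ^ 2 + a₀ ^ 2)) := by
      have h2 : (1 + r ^ 2) * y ^ 2 ≤ C * E * ((r ^ 2)⁻¹ ^ 2 * a₂ ^ 2 +
          (1 + r ^ 2) * (r⁻¹ ^ 2 * a₁ ^ 2 + a₀ ^ 2)) := by
        refine le_trans ?_ hd
        have : 0 ≤ (r ^ 2)⁻¹ ^ 2 * ‖(flow α β κ (r ^ 2) t v).2.2‖ ^ 2 := by positivity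
        have : 0 ≤ (1 + r ^ 2) * (r⁻¹ ^ 2 * ‖(flow α β κ (r ^ 2) t v).2.1‖ ^ 2) := by positivity
        linarith
      refine h2.trans ?_
      have h3 : (r ^ 2)⁻¹ ^ 2 * a₂ ^ 2 ≤ (1 + r ^ 2) * (a₂ ^ 2 / r ^ 4) := by
        have : (r ^ 2)⁻¹ ^ 2 * a₂ ^ 2 = a₂ ^ 2 / r ^ 4 := by field_simp
        rw [this]
        exact le_mul_of_one_le_left (by positivity) (by linarith)
      have h4 : r⁻¹ ^ 2 * a₁ ^ 2 = a₁ ^ 2 / r ^ 2 := by field_simp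
      rw [h4]
      gcongr
      linarith
    have h5 : (1 + r ^ 2) * y ^ 2 ≤
        (1 + r ^ 2) * (C * E * (a₂ ^ 2 / r ^ 4 + a₁ ^ 2 / r ^ 2 + a₀ ^ 2)) := by linarith
    exact le_of_mul_le_mul_left h5 (by positivity)
  rw [← hy, ← ha₀, ← ha₁, ← ha₂]
  refine ⟨fun h1 => ?_, fun h1 => ?_, fun h1 h2 => ?_⟩
  · have e1 : a₂ ^ 2 / r ^ 4 ≤ a₂ ^ 2 := div_le_self (by positivity) (one_le_pow₀ h1)
    have e2 : a₁ ^ 2 / r ^ 2 ≤ a₁ ^ 2 := div_le_self (by positivity) (one_le_pow₀ h1)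
    have e3 : E ≤ Real.exp (-(c / 2 * t)) := by
      rw [hE, Real.exp_le_exp]
      have : 1 / 2 ≤ r ^ 2 / (1 + r ^ 2) := by
        rw [div_le_div_iff₀ (by norm_num) (by positivity)]
        nlinarith
      have : c * (1 / 2) * t ≤ c * (r ^ 2 / (1 + r ^ 2)) * t := by gcongr
      linarith
    calc y ^ 2 ≤ C * E * (a₂ ^ 2 / r ^ 4 + a₁ ^ 2 / r ^ 2 + a₀ ^ 2) := hy2
      _ ≤ (C + (1 + K) ^ 2) * Real.exp (-(c / 2 * t)) * (a₂ ^ 2 + a₁ ^ 2 + a₀ ^ 2) := by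
        gcongr
      _ = _ := by ring
  · have e1 : a₁ ^ 2 / r ^ 2 ≤ a₁ ^ 2 / r ^ 4 := by
      gcongr _ / ?_
      exact pow_le_pow_of_le_one hr.le h1 (by norm_num)
    have e2 : a₀ ^ 2 ≤ a₀ ^ 2 / r ^ 4 :=
      le_div_self (by positivity) (by positivity) (pow_le_one₀ hr.le h1)
    have e3 : E ≤ Real.exp (-(c / 2 * r ^ 2 * t)) := by
      rw [hE, Real.exp_le_exp]
      have : r ^ 2 / 2 ≤ r ^ 2 / (1 + r ^ 2) := by gcongr; nlinarith
      have : c * (r ^ 2 / 2) * t ≤ c * (r ^ 2 / (1 + r ^ 2)) * t := by gcongr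
      linarith
    have e4 : a₂ ^ 2 / r ^ 4 + a₁ ^ 2 / r ^ 2 + a₀ ^ 2 ≤ (r ^ 4)⁻¹ * (a₀ + a₁ + a₂) ^ 2 := by
      have : a₂ ^ 2 / r ^ 4 + a₁ ^ 2 / r ^ 4 + a₀ ^ 2 / r ^ 4 =
        (r ^ 4)⁻¹ * (a₂ ^ 2 + a₁ ^ 2 + a₀ ^ 2) := by field_simp
      have h3 : (r ^ 4)⁻¹ * (a₂ ^ 2 + a₁ ^ 2 + a₀ ^ 2) ≤ (r ^ 4)⁻¹ * (a₀ + a₁ + a₂) ^ 2 := by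
        gcongr
        exact sum_sq_le_sq_sum p₀ p₁ p₂
      linarith
    calc y ^ 2 ≤ C * E * (a₂ ^ 2 / r ^ 4 + a₁ ^ 2 / r ^ 2 + a₀ ^ 2) := hy2
      _ ≤ (C + (1 + K) ^ 2) * Real.exp (-(c / 2 * r ^ 2 * t)) *
          ((r ^ 4)⁻¹ * (a₀ + a₁ + a₂) ^ 2) := by gcongr
      _ = _ := by ring
  · have hs := HK r hr h1 _ _ _ (isMode_flow α β κ hr v) t ht0
    simp only [flow_zero, norm_smul, norm_inv, Real.norm_of_nonneg hr.le,
      Real.norm_of_nonneg (sq_nonneg r)] at hs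
    rw [← hy, ← ha₀, ← ha₁, ← ha₂] at hs
    have hrt : r * t ≤ 1 := by
      calc r * t ≤ t⁻¹ * t := by gcongr
        _ = 1 := by field_simp
    have hrt0 : 0 ≤ r * t := by positivity
    have t2 : t ≤ t ^ 2 := by nlinarith
    have t3 : 1 ≤ t ^ 2 := by nlinarith
    have e1 : r * t * (r⁻¹ * a₁) = t * a₁ := by field_simp
    have e2 : (r * t) ^ 2 * (a₀ + r⁻¹ * a₁ + (r ^ 2)⁻¹ * a₂) =
        (r * t) ^ 2 * a₀ + (r * t) * t * a₁ + t ^ 2 * a₂ := by field_simp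
    have e3 : (r * t) ^ 2 * a₀ ≤ t ^ 2 * a₀ := by
      gcongr
      nlinarith
    have e4 : (r * t) * t * a₁ ≤ t ^ 2 * a₁ := by
      gcongr
      nlinarith
    have e5 : K * (r * t) ^ 2 * (a₀ + r⁻¹ * a₁ + (r ^ 2)⁻¹ * a₂) ≤
        K * (t ^ 2 * a₀ + t ^ 2 * a₁ + t ^ 2 * a₂) := by
      rw [mul_assoc, e2]
      gcongr
    have e6 : t * a₁ ≤ t ^ 2 * a₁ := by gcongr
    have e7 : a₀ ≤ t ^ 2 * a₀ := le_mul_of_one_le_left p₀ t3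
    have e8 : 0 ≤ t ^ 2 * a₂ := by positivity
    have hy0 : 0 ≤ y := hy ▸ norm_nonneg _
    have h3 : y ≤ (1 + K) * t ^ 2 * (a₀ + a₁ + a₂) := by linarith
    calc y ^ 2 ≤ ((1 + K) * t ^ 2 * (a₀ + a₁ + a₂)) ^ 2 := by gcongr
      _ = (1 + K) ^ 2 * t ^ 4 * (a₀ + a₁ + a₂) ^ 2 := by ring
      _ ≤ (C + (1 + K) ^ 2) * t ^ 4 * (a₀ + a₁ + a₂) ^ 2 := by
        gcongr
        linarith

/-- With `ε = 1/(2K)` the drift costs at most half of the total data, which leaves `1/2` of the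
leading datum and raises the other coefficients to `3/2`. -/
lemma le_norm_flow {α β κ : ℝ} (hκ : 0 < κ) (hα : κ < α) (hβ : 0 < β) :
    ∃ ε : ℝ, 0 < ε ∧ ∀ t : ℝ, 0 ≤ t → ∀ r : ℝ, 0 < r → r ≤ 1 → r ^ 2 * t ≤ ε →
      Real.cos (r * t) ≤ 0 → ∀ v : ℂ × ℂ × ℂ,
        ‖v.2.2‖ / 2 - 3 / 2 * r * (‖v.1‖ + ‖v.2.1‖) ≤ r ^ 2 * ‖(flow α β κ (r ^ 2) t v).1‖ := by
  obtain ⟨K, hK, H⟩ := IsMode.lower hκ hα hβ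
  refine ⟨1 / (2 * K), by positivity, fun t ht r hr hr1 hε hcos v => ?_⟩
  have h := H r hr hr1 _ _ _ (isMode_flow α β κ hr v) t ht hcos
  simp only [flow_zero, norm_smul, norm_inv, Real.norm_of_nonneg hr.le,
    Real.norm_of_nonneg (sq_nonneg r)] at h
  have hk : K * (r ^ 2 * t) ≤ 1 / 2 := by
    calc K * (r ^ 2 * t) ≤ K * (1 / (2 * K)) := by gcongr
      _ = 1 / 2 := by field_simp
  have h1 : K * (r ^ 2 * t) * (‖v.1‖ + r⁻¹ * ‖v.2.1‖ + (r ^ 2)⁻¹ * ‖v.2.2‖) ≤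
      1 / 2 * (‖v.1‖ + r⁻¹ * ‖v.2.1‖ + (r ^ 2)⁻¹ * ‖v.2.2‖) := by gcongr
  have h2 : (r ^ 2)⁻¹ * ‖v.2.2‖ / 2 - 3 / 2 * ‖v.1‖ - 3 / 2 * (r⁻¹ * ‖v.2.1‖) ≤
      ‖(flow α β κ (r ^ 2) t v).1‖ := by linarith
  have h3 := mul_le_mul_of_nonneg_left h2 (sq_nonneg r)
  have h4 : r ^ 2 * ((r ^ 2)⁻¹ * ‖v.2.2‖ / 2 - 3 / 2 * ‖v.1‖ - 3 / 2 * (r⁻¹ * ‖v.2.1‖)) =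
      ‖v.2.2‖ / 2 - 3 / 2 * r ^ 2 * ‖v.1‖ - 3 / 2 * r * ‖v.2.1‖ := by field_simp
  have h5 : r ^ 2 * ‖v.1‖ ≤ r * ‖v.1‖ := by
    gcongr
    nlinarith
  linarith

/-! ### Transforms of the data and asymptotics of the rate. -/

lemma integral_norm_le_normL2L11 {f : Space n → ℂ} (hf : MemL2L11 f) :
    ∫ x, ‖f x‖ ≤ normL2L11 f := by
  have h : ∫ x, ‖f x‖ ≤ ∫ x, (1 + ‖x‖) * ‖f x‖ :=
    integral_mono hf.integrable.norm hf.2 fun x => by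
      nlinarith [norm_nonneg x, norm_nonneg (f x), mul_nonneg (norm_nonneg x) (norm_nonneg (f x))]
  exact h.trans (le_add_of_nonneg_left ENNReal.toReal_nonneg)

lemma normL2L11_nonneg (f : Space n → ℂ) : 0 ≤ normL2L11 f :=
  add_nonneg ENNReal.toReal_nonneg (integral_nonneg fun x => by positivity)

lemma norm_fourierInv_le {f : Space n → ℂ} (hf : MemL2L11 f) (ξ : Space n) :
    ‖𝓕⁻ f ξ‖ ≤ normL2L11 f := by
  refine le_trans ?_ (integral_norm_le_normL2L11 hf)
  rw [Real.fourierInv_eq]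
  refine (norm_integral_le_integral_norm _).trans_eq ?_
  simp

/-- The integral defining `𝓕⁻` and its `L²` extension agree almost everywhere because they pair
alike with test functions, so Plancherel applies to the former. -/
lemma integral_norm_sq_fourierInv {f : Space n → ℂ} (hf : MemL2L11 f) :
    Integrable (fun ξ => ‖𝓕⁻ f ξ‖ ^ 2) ∧ ∫ ξ, ‖𝓕⁻ f ξ‖ ^ 2 ≤ normL2L11 f ^ 2 := by
  have hae : ((𝓕⁻ (hf.1.toLp f) : L2 n) : Space n → ℂ) =ᵐ[volume] 𝓕⁻ f := by
    refine ae_eq_of_pairing_eq _ (continuous_fourierInv hf.integrable) fun χ _ => ?_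
    rw [← pairing_fourierInv, pairing_congr hf.1.coeFn_toLp,
      pairing_fourierInv_of_integrable hf.integrable]
  have hae2 : (fun ξ => ‖(𝓕⁻ (hf.1.toLp f) : L2 n) ξ‖ ^ 2) =ᵐ[volume] fun ξ => ‖𝓕⁻ f ξ‖ ^ 2 :=
    hae.mono fun ξ hξ => by simp only [hξ]
  refine ⟨(integrable_norm_sq _).congr hae2, ?_⟩
  rw [← integral_congr_ae hae2, integral_norm_sq_eq, norm_fourierInv_L2, Lp.norm_toLp]
  gcongr
  exact le_add_of_nonneg_right (integral_nonneg fun x => by positivity)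

lemma fourierInv_zero (f : Space n → ℂ) : 𝓕⁻ f 0 = ∫ x, f x := by
  simp [Real.fourierInv_eq]

lemma exp_neg_le_rate_sq (hn : 3 ≤ n) {c : ℝ} (hc : 0 < c) :
    ∀ᶠ t in atTop, Real.exp (-(c * t)) ≤ rate n t ^ 2 := by
  have hexp : ∀ t : ℝ, 0 ≤ t → Real.exp (-(c * t)) ≤ 1 := fun t ht => by
    rw [Real.exp_le_one_iff]
    have : 0 ≤ c * t := by positivity
    linarith
  obtain rfl | rfl | h : n = 3 ∨ n = 4 ∨ 5 ≤ n := by omega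
  · filter_upwards [eventually_ge_atTop 1] with t ht
    rw [rate_three_sq (by linarith)]
    exact (hexp t (by linarith)).trans ht
  · filter_upwards [eventually_ge_atTop 3] with t ht
    rw [rate_four_sq (by linarith)]
    refine (hexp t (by linarith)).trans ?_
    rw [Real.le_log_iff_exp_le (by linarith)]
    linarith [Real.exp_one_lt_d9]
  · have := (isLittleO_exp_neg_mul_rpow_atTop hc (-((n : ℝ) - 4) / 2)).bound one_pos
    filter_upwards [this, eventually_ge_atTop 0] with t h1 ht
    rw [rate_sq_of_five_le h ht]
    rw [one_mul, Real.norm_of_nonneg (Real.exp_pos _).le,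
      Real.norm_of_nonneg (by positivity)] at h1
    rwa [← neg_mul]

lemma rate_pos (n : ℕ) {t : ℝ} (ht : 1 < t) : 0 < rate n t := by
  have := Real.log_pos ht
  unfold rate
  split_ifs <;> positivity

lemma tendsto_rate_atTop (hn : 3 ≤ n) (hn' : n ≤ 4) : Tendsto (rate n) atTop atTop := by
  obtain rfl | rfl : n = 3 ∨ n = 4 := by omega
  · have : rate 3 = fun t : ℝ => t ^ (1 / 2 : ℝ) := by
      ext t; rw [rate, if_pos le_rfl]; norm_num
    rw [this]
    exact tendsto_rpow_atTop (by norm_num)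
  · have : rate 4 = fun t : ℝ => Real.log t ^ (1 / 2 : ℝ) := by
      ext t; rw [rate, if_neg (by norm_num), if_pos rfl]
    rw [this]
    exact (tendsto_rpow_atTop (by norm_num)).comp Real.tendsto_log_atTop

lemma tendsto_rate_zero (hn : 5 ≤ n) : Tendsto (rate n) atTop (𝓝 0) := by
  have : rate n = fun t : ℝ => t ^ (-((n : ℝ) / 4 - 1)) := by
    ext t; rw [rate_of_five_le hn, neg_sub]
  rw [this]
  have hn5 : (5 : ℝ) ≤ n := by exact_mod_cast hn
  exact tendsto_rpow_neg_atTop (by linarith)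

/-! ### Upper and lower bounds in frequency space. -/

section bounds

variable {α β κ : ℝ}

lemma integral_fourierSolution_le (hn : 3 ≤ n) (hκ : 0 < κ) (hα : κ < α) (hβ : 0 < β) :
    ∃ C T : ℝ, 0 < C ∧ 3 ≤ T ∧ ∀ t, T ≤ t → ∀ ψ₀ ψ₁ ψ₂ : Space n → ℂ,
      MemL2L11 ψ₀ → MemL2L11 ψ₁ → MemL2L11 ψ₂ →
      Integrable (fun ξ => ‖(fourierSolution α β κ ψ₀ ψ₁ ψ₂ t ξ).1‖ ^ 2) →
      ∫ ξ, ‖(fourierSolution α β κ ψ₀ ψ₁ ψ₂ t ξ).1‖ ^ 2 ≤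
        C * rate n t ^ 2 * (normL2L11 ψ₀ + normL2L11 ψ₁ + normL2L11 ψ₂) ^ 2 := by
  obtain ⟨c, C₁, hc, hC₁, H⟩ := norm_flow_le hκ hα hβ
  obtain ⟨C₂, hC₂, HG⟩ := exists_hasLowFrequencyMajorant hn hc
  obtain ⟨σ, hσ, Hσ⟩ := exists_radial_constant (n := n) (by omega)
  obtain ⟨T, hT⟩ := eventually_atTop.1 (exp_neg_le_rate_sq hn hc)
  refine ⟨C₁ * (σ * C₂) + C₁, max 3 T, by positivity, le_max_left _ _,
    fun t ht ψ₀ ψ₁ ψ₂ h₀ h₁ h₂ hint => ?_⟩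
  have ht3 : 3 ≤ t := (le_max_left _ _).trans ht
  obtain ⟨G, hG0, hGi, hGle, hG⟩ := HG t ht3
  obtain ⟨N, hN⟩ : ∃ N, N = normL2L11 ψ₀ + normL2L11 ψ₁ + normL2L11 ψ₂ := ⟨_, rfl⟩
  have q₀ := normL2L11_nonneg ψ₀
  have q₁ := normL2L11_nonneg ψ₁
  have q₂ := normL2L11_nonneg ψ₂
  obtain ⟨i₀, I₀⟩ := integral_norm_sq_fourierInv h₀
  obtain ⟨i₁, I₁⟩ := integral_norm_sq_fourierInv h₁
  obtain ⟨i₂, I₂⟩ := integral_norm_sq_fourierInv h₂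
  have i₀₁ : Integrable fun ξ => ‖𝓕⁻ ψ₀ ξ‖ ^ 2 + ‖𝓕⁻ ψ₁ ξ‖ ^ 2 := i₀.add i₁
  have i₀₁₂ : Integrable fun ξ => ‖𝓕⁻ ψ₀ ξ‖ ^ 2 + ‖𝓕⁻ ψ₁ ξ‖ ^ 2 + ‖𝓕⁻ ψ₂ ξ‖ ^ 2 := i₀₁.add i₂
  -- The majorant already contains the Jacobian `r^(n-1)`, which is divided out before returning to
  -- `ξ`.
  have hGG : EqOn (fun r : ℝ => r ^ (n - 1) * (G r / r ^ (n - 1))) G (Ioi 0) := fun r hr => by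
    have : 0 < r := hr
    field_simp
  obtain ⟨e, he⟩ := Hσ fun r => G r / r ^ (n - 1)
  have hgi := he (hGi.congr_fun hGG.symm measurableSet_Ioi)
  rw [setIntegral_congr_fun measurableSet_Ioi hGG] at e
  have hpt : ∀ᵐ ξ : Space n, ‖(fourierSolution α β κ ψ₀ ψ₁ ψ₂ t ξ).1‖ ^ 2 ≤
      C₁ * N ^ 2 * (G (2 * Real.pi * ‖ξ‖) / (2 * Real.pi * ‖ξ‖) ^ (n - 1))
        + C₁ * Real.exp (-(c * t)) * (‖𝓕⁻ ψ₀ ξ‖ ^ 2 + ‖𝓕⁻ ψ₁ ξ‖ ^ 2 + ‖𝓕⁻ ψ₂ ξ‖ ^ 2) := by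
    have : Nonempty (Fin n) := ⟨⟨0, by omega⟩⟩
    have hne : ∀ᵐ ξ : Space n, ξ ≠ 0 := by
      rw [ae_iff]; simp
    filter_upwards [hne] with ξ hξ
    have hr : 0 < 2 * Real.pi * ‖ξ‖ := by
      have := Real.pi_pos
      have := norm_pos_iff.2 hξ
      positivity
    obtain ⟨r, hrdef⟩ : ∃ r, r = 2 * Real.pi * ‖ξ‖ := ⟨_, rfl⟩
    rw [fourierSolution, ← hrdef]
    rw [← hrdef] at hr
    obtain ⟨H1, H2, H3⟩ := H t (by linarith) r hr (𝓕⁻ ψ₀ ξ, 𝓕⁻ ψ₁ ξ, 𝓕⁻ ψ₂ ξ)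
    dsimp only at H1 H2 H3
    have hGr := hG0 r hr
    have hS : ‖𝓕⁻ ψ₀ ξ‖ + ‖𝓕⁻ ψ₁ ξ‖ + ‖𝓕⁻ ψ₂ ξ‖ ≤ N := by
      rw [hN]
      exact add_le_add_three (norm_fourierInv_le h₀ ξ) (norm_fourierInv_le h₁ ξ)
        (norm_fourierInv_le h₂ ξ)
    have hlow : ∀ A : ℝ, 0 ≤ A → r ^ (n - 1) * A ≤ G r →
        C₁ * A * (‖𝓕⁻ ψ₀ ξ‖ + ‖𝓕⁻ ψ₁ ξ‖ + ‖𝓕⁻ ψ₂ ξ‖) ^ 2 ≤ C₁ * N ^ 2 * (G r / r ^ (n - 1))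
        + C₁ * Real.exp (-(c * t)) * (‖𝓕⁻ ψ₀ ξ‖ ^ 2 + ‖𝓕⁻ ψ₁ ξ‖ ^ 2 + ‖𝓕⁻ ψ₂ ξ‖ ^ 2) := by
      intro A hA hAG
      have h1 : A ≤ G r / r ^ (n - 1) := by
        rw [le_div_iff₀ (by positivity)]
        linarith
      have h2 : C₁ * A * (‖𝓕⁻ ψ₀ ξ‖ + ‖𝓕⁻ ψ₁ ξ‖ + ‖𝓕⁻ ψ₂ ξ‖) ^ 2 ≤
          C₁ * (G r / r ^ (n - 1)) * N ^ 2 := by gcongr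
      have h3 : 0 ≤ C₁ * Real.exp (-(c * t)) *
        (‖𝓕⁻ ψ₀ ξ‖ ^ 2 + ‖𝓕⁻ ψ₁ ξ‖ ^ 2 + ‖𝓕⁻ ψ₂ ξ‖ ^ 2) := by positivity
      linarith
    rcases le_total r 1 with hr1 | hr1
    · rcases le_or_gt r t⁻¹ with hrt | hrt
      · exact (H3 hr1 hrt).trans (hlow _ (by positivity) ((hG r hr hr1).1 hrt))
      · exact (H2 hr1).trans (hlow _ (by positivity) ((hG r hr hr1).2 hrt))
    · refine (H1 hr1).trans (le_add_of_nonneg_left ?_)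
      positivity
  rw [← hN]
  calc ∫ ξ, ‖(fourierSolution α β κ ψ₀ ψ₁ ψ₂ t ξ).1‖ ^ 2
      ≤ ∫ ξ, (C₁ * N ^ 2 * (G (2 * Real.pi * ‖ξ‖) / (2 * Real.pi * ‖ξ‖) ^ (n - 1))
        + C₁ * Real.exp (-(c * t)) *
          (‖𝓕⁻ ψ₀ ξ‖ ^ 2 + ‖𝓕⁻ ψ₁ ξ‖ ^ 2 + ‖𝓕⁻ ψ₂ ξ‖ ^ 2)) :=
        integral_mono_ae hint ((hgi.const_mul _).add (i₀₁₂.const_mul _)) hpt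
    _ = C₁ * N ^ 2 * (σ * ∫ r in Ioi 0, G r) + C₁ * Real.exp (-(c * t)) *
        ((∫ ξ, ‖𝓕⁻ ψ₀ ξ‖ ^ 2) + (∫ ξ, ‖𝓕⁻ ψ₁ ξ‖ ^ 2) + ∫ ξ, ‖𝓕⁻ ψ₂ ξ‖ ^ 2) := by
      rw [integral_add (hgi.const_mul _) (i₀₁₂.const_mul _), integral_const_mul,
        integral_const_mul, e]
      congr 2
      rw [integral_add i₀₁ i₂, integral_add i₀ i₁]
    _ ≤ C₁ * N ^ 2 * (σ * (C₂ * rate n t ^ 2)) + C₁ * rate n t ^ 2 * N ^ 2 := by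
      gcongr
      · exact hT t ((le_max_right _ _).trans ht)
      · have := sum_sq_le_sq_sum q₀ q₁ q₂
        rw [← hN] at this
        linarith
    _ = _ := by ring

lemma le_integral_fourierSolution (hn : 3 ≤ n) (hκ : 0 < κ) (hα : κ < α) (hβ : 0 < β) :
    ∃ c : ℝ, 0 < c ∧ ∀ ψ₀ ψ₁ ψ₂ : Space n → ℂ,
      MemL2L11 ψ₀ → MemL2L11 ψ₁ → MemL2L11 ψ₂ → (∫ x, ψ₂ x) ≠ 0 →
      ∀ᶠ t in atTop, Integrable (fun ξ => ‖(fourierSolution α β κ ψ₀ ψ₁ ψ₂ t ξ).1‖ ^ 2) →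
        c * rate n t ^ 2 * ‖∫ x, ψ₂ x‖ ^ 2 ≤
          ∫ ξ, ‖(fourierSolution α β κ ψ₀ ψ₁ ψ₂ t ξ).1‖ ^ 2 := by
  obtain ⟨ε, hε, H⟩ := le_norm_flow hκ hα hβ
  obtain ⟨c, hc, hS⟩ := exists_oscillationSet hn hε
  obtain ⟨σ, hσ, Hσ⟩ := exists_radial_constant (n := n) (by omega)
  refine ⟨1 / 64 * (σ * c), by positivity, fun ψ₀ ψ₁ ψ₂ h₀ h₁ h₂ hP => ?_⟩
  obtain ⟨P, hPdef⟩ : ∃ P, P = ‖∫ x, ψ₂ x‖ := ⟨_, rfl⟩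
  have hP0 : 0 < P := hPdef ▸ norm_pos_iff.2 hP
  obtain ⟨N, hN⟩ : ∃ N, N = normL2L11 ψ₀ + normL2L11 ψ₁ := ⟨_, rfl⟩
  have hN0 : 0 ≤ N := hN ▸ add_nonneg (normL2L11_nonneg _) (normL2L11_nonneg _)
  -- Near frequency zero the transform of `ψ₂` stays close to its value `∫ ψ₂`.
  obtain ⟨ρ, hρ, Hρ⟩ : ∃ ρ : ℝ, 0 < ρ ∧ ∀ ξ : Space n, 2 * Real.pi * ‖ξ‖ ≤ ρ →
      P / 2 ≤ ‖𝓕⁻ ψ₂ ξ‖ := by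
    have hcont := (continuous_fourierInv h₂.integrable).norm.continuousAt (x := 0)
    have h0 : P / 2 < ‖𝓕⁻ ψ₂ 0‖ := by rw [fourierInv_zero, ← hPdef]; linarith
    obtain ⟨δ, hδ, Hδ⟩ := Metric.eventually_nhds_iff.1 (hcont.eventually_const_lt h0)
    refine ⟨δ, hδ, fun ξ hξ => (Hδ ?_).le⟩
    rw [dist_zero_right]
    rcases eq_or_ne ξ 0 with rfl | hξ0
    · simpa using hδ
    · have := norm_pos_iff.2 hξ0
      nlinarith [Real.pi_gt_three]
  -- With `r ≤ τ` the terms from `ψ₀, ψ₁` cost at most `(3/2)τN ≤ P/8`. From `(P/2)/2 = P/4` there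
  -- remains `P/8`, whose square gives `1/64`.
  obtain ⟨τ, hτ, hτ'⟩ : ∃ τ : ℝ, 0 < τ ∧ τ < min (min 1 ρ) (P / (12 * (N + 1))) := by
    apply exists_between; positivity
  simp only [lt_min_iff] at hτ'
  obtain ⟨⟨hτ1, hτρ⟩, hτN⟩ := hτ'
  rw [lt_div_iff₀ (by positivity)] at hτN
  -- The last condition turns `r² t ≤ ε` into `r ≤ τ`.
  filter_upwards [hS, eventually_gt_atTop 1, eventually_ge_atTop (ε / τ ^ 2)] with t hSt ht1 htτ hint
  obtain ⟨Y, X, hY, hX, hle⟩ := hSt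
  have ht0 : 0 < t := by linarith
  rw [div_le_iff₀ (by positivity)] at htτ
  have hrate := rate_pos n ht1
  obtain ⟨S, hSdef⟩ : ∃ S, S = oscillationSet t Y X := ⟨_, rfl⟩
  rw [← hSdef] at hle
  obtain ⟨e, he⟩ := Hσ (S.indicator fun r => (r ^ 4)⁻¹)
  have hgi : Integrable fun ξ : Space n =>
      S.indicator (fun r => (r ^ 4)⁻¹) (2 * Real.pi * ‖ξ‖) := by
    apply he
    -- A non-integrable function has integral zero by convention, which would contradict the
    -- positive lower bound.
    by_contra hni
    rw [integral_undef hni] at hle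
    have : 0 < c * rate n t ^ 2 := by positivity
    linarith
  have hpt : ∀ ξ : Space n, P ^ 2 / 64 * S.indicator (fun r => (r ^ 4)⁻¹) (2 * Real.pi * ‖ξ‖) ≤
      ‖(fourierSolution α β κ ψ₀ ψ₁ ψ₂ t ξ).1‖ ^ 2 := by
    intro ξ
    by_cases hξ : 2 * Real.pi * ‖ξ‖ ∈ S
    · rw [indicator_of_mem hξ]
      have hρξ := Hρ ξ
      rw [fourierSolution]
      obtain ⟨r, hrdef⟩ : ∃ r, r = 2 * Real.pi * ‖ξ‖ := ⟨_, rfl⟩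
      rw [← hrdef] at hξ hρξ ⊢
      rw [hSdef] at hξ
      obtain ⟨hcos, hrY, hrX⟩ := hξ
      have hrt : 0 < r * t := hY.trans hrY
      have hr : 0 < r := pos_of_mul_pos_left hrt ht0.le
      have h1 : r ^ 2 * t ≤ ε := by
        have : (r * t) ^ 2 ≤ ε * t := (pow_le_pow_left₀ hrt.le hrX 2).trans hX
        have : r ^ 2 * t * t ≤ ε * t := by linarith
        exact le_of_mul_le_mul_right this ht0
      have h2 : r ≤ τ := by
        have : r ^ 2 * t ≤ τ ^ 2 * t := by linarith
        exact le_of_sq_le_sq (le_of_mul_le_mul_right this ht0) hτ.le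
      have h3 := H t ht0.le r hr (by linarith) h1 hcos (𝓕⁻ ψ₀ ξ, 𝓕⁻ ψ₁ ξ, 𝓕⁻ ψ₂ ξ)
      dsimp only at h3
      have h4 := hρξ (by linarith)
      have h5 : ‖𝓕⁻ ψ₀ ξ‖ + ‖𝓕⁻ ψ₁ ξ‖ ≤ N := by
        rw [hN]
        exact add_le_add (norm_fourierInv_le h₀ ξ) (norm_fourierInv_le h₁ ξ)
      have h6 : r * (‖𝓕⁻ ψ₀ ξ‖ + ‖𝓕⁻ ψ₁ ξ‖) ≤ τ * N := by gcongr
      have h7 : P / 8 ≤ r ^ 2 *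
          ‖(flow α β κ (r ^ 2) t (𝓕⁻ ψ₀ ξ, 𝓕⁻ ψ₁ ξ, 𝓕⁻ ψ₂ ξ)).1‖ := by linarith
      have h8 := pow_le_pow_left₀ (by positivity) h7 2
      rw [← div_eq_mul_inv, div_le_iff₀ (by positivity)]
      linarith
    · rw [indicator_of_notMem hξ, mul_zero]
      positivity
  have hfin := integral_mono (hgi.const_mul (P ^ 2 / 64)) hint hpt
  rw [integral_const_mul, e] at hfin
  rw [← hPdef]
  calc 1 / 64 * (σ * c) * rate n t ^ 2 * P ^ 2 = P ^ 2 / 64 * (σ * (c * rate n t ^ 2)) := by ring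
    _ ≤ _ := by gcongr
    _ ≤ _ := hfin

end bounds

end Blackstock

/-! ### Conclusion by Plancherel. -/

open Blackstock in
theorem mainTheorem1 (n : ℕ) (hn : 3 ≤ n) (κ γ b ν : ℝ)
    (hκ : 0 < κ) (hγ : 1 < γ) (hγ' : γ ≤ 5 / 3) (hb : 0 < b) (hν : 0 < ν) :
    ∃ c C T₀ : ℝ, 0 < c ∧ 0 < C ∧ 0 < T₀ ∧
      ∀ ψ₀ ψ₁ ψ₂ : Blackstock.Space n → ℂ,
        Blackstock.MemL2L11 ψ₀ → Blackstock.MemL2L11 ψ₁ → Blackstock.MemL2L11 ψ₂ →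
        (∫ x, ψ₂ x) ≠ 0 →
        ∀ ψ : ℝ → Blackstock.L2 n, Blackstock.IsSolution κ γ b ν ψ₀ ψ₁ ψ₂ ψ →
          (∀ t : ℝ, T₀ ≤ t →
            ‖ψ t‖ ≤ C * Blackstock.rate n t *
              (Blackstock.normL2L11 ψ₀ + Blackstock.normL2L11 ψ₁ + Blackstock.normL2L11 ψ₂)) ∧
          (∃ T : ℝ, T₀ ≤ T ∧ ∀ t : ℝ, T ≤ t →
            c * Blackstock.rate n t * ‖∫ x, ψ₂ x‖ ≤ ‖ψ t‖) ∧
          (n ≤ 4 → Tendsto (fun t => ‖ψ t‖) atTop atTop) ∧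
          (5 ≤ n → Tendsto (fun t => ‖ψ t‖) atTop (𝓝 0)) := by
  obtain ⟨α, hαd⟩ : ∃ α, α = delta κ γ b ν + κ := ⟨_, rfl⟩
  obtain ⟨β, hβd⟩ : ∃ β, β = κ * delta κ γ b ν + κ * (γ - 1) * (b * ν - κ) := ⟨_, rfl⟩
  have hbν : 0 < b * ν := by positivity
  have hα : κ < α := by
    have : 0 < (γ - 1) * κ := mul_pos (by linarith) hκ
    rw [hαd, delta]
    linarith
  have hβ : 0 < β := by
    -- The `κ²` contributions of `δ` and of `bν - κ` cancel, so `β > 0` whatever the sign of `bν -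
    -- κ`.
    have : β = κ * γ * (b * ν) := by rw [hβd, delta]; ring
    rw [this]
    positivity
  obtain ⟨C, T₀, hC, hT₀, HU⟩ := integral_fourierSolution_le (n := n) hn hκ hα hβ
  obtain ⟨c, hc, HL⟩ := le_integral_fourierSolution (n := n) hn hκ hα hβ
  refine ⟨√c, √C, T₀, by positivity, by positivity, by linarith,
    fun ψ₀ ψ₁ ψ₂ h₀ h₁ h₂ hP ψ hψ => ?_⟩
  have hN : 0 ≤ normL2L11 ψ₀ + normL2L11 ψ₁ + normL2L11 ψ₂ :=
    add_nonneg (add_nonneg (normL2L11_nonneg _) (normL2L11_nonneg _)) (normL2L11_nonneg _)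
  have hsol : ∀ t, 0 ≤ t →
      Integrable (fun ξ => ‖(fourierSolution α β κ ψ₀ ψ₁ ψ₂ t ξ).1‖ ^ 2) ∧
      ∫ ξ, ‖(fourierSolution α β κ ψ₀ ψ₁ ψ₂ t ξ).1‖ ^ 2 = ‖ψ t‖ ^ 2 := by
    intro t ht
    have h := hψ.fourierInv_ae_eq hκ.le (by rw [← hαd]; linarith) (by rw [← hβd]; exact hβ.le)
      h₀.integrable h₁.integrable h₂.integrable ht
    rw [← hαd, ← hβd] at h
    have h' := h.mono fun ξ hξ => congrArg (fun z => ‖z‖ ^ 2) hξ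
    refine ⟨(integrable_norm_sq _).congr h', ?_⟩
    rw [← norm_fourierInv_L2, ← integral_norm_sq_eq]
    exact (integral_congr_ae h').symm
  have hup : ∀ t : ℝ, T₀ ≤ t → ‖ψ t‖ ≤ √C * rate n t *
      (normL2L11 ψ₀ + normL2L11 ψ₁ + normL2L11 ψ₂) := by
    intro t ht
    obtain ⟨hi, he⟩ := hsol t (by linarith)
    have h := HU t ht ψ₀ ψ₁ ψ₂ h₀ h₁ h₂ hi
    rw [he] at h
    have hr := rate_nonneg n (t := t) (by linarith)
    apply le_of_sq_le_sq _ (by positivity)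
    rwa [mul_pow, mul_pow, Real.sq_sqrt hC.le]
  have hlow : ∃ T : ℝ, T₀ ≤ T ∧ ∀ t : ℝ, T ≤ t → √c * rate n t * ‖∫ x, ψ₂ x‖ ≤ ‖ψ t‖ := by
    obtain ⟨T, hT⟩ := eventually_atTop.1 (HL ψ₀ ψ₁ ψ₂ h₀ h₁ h₂ hP)
    refine ⟨max T₀ T, le_max_left _ _, fun t ht => ?_⟩
    obtain ⟨hi, he⟩ := hsol t (by linarith [le_max_left T₀ T])
    have h := hT t ((le_max_right _ _).trans ht) hi
    rw [he] at h
    apply le_of_sq_le_sq _ (norm_nonneg _)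
    rwa [mul_pow, mul_pow, Real.sq_sqrt hc.le]
  refine ⟨hup, hlow, fun hn4 => ?_, fun hn5 => ?_⟩
  · obtain ⟨T, -, hT⟩ := hlow
    refine tendsto_atTop_mono' atTop ((eventually_ge_atTop T).mono hT) ?_
    exact ((tendsto_rate_atTop hn hn4).const_mul_atTop (Real.sqrt_pos.2 hc)).atTop_mul_const
      (norm_pos_iff.2 hP)
  · refine squeeze_zero' (Eventually.of_forall fun t => norm_nonneg _)
      ((eventually_ge_atTop T₀).mono hup) ?_
    simpa using ((tendsto_rate_zero hn5).const_mul (√C)).mul_const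
      (normL2L11 ψ₀ + normL2L11 ψ₁ + normL2L11 ψ₂)
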